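/- **Model.** Amoebots live on the nodes of the infinite triangular grid with axial coordinates in $\mathbb Z^2$ (the neighbours of $v$ are $v\pm(1,0)$, $v\pm(0,1)$, $v\pm(1,-1)$). Each amoebot occupies one node (contracted) or two adjacent nodes (expanded), and no node is occupied twice. Bonds are all grid edges between nodes of different amoebots. A structure is connected if the graph formed by the bonds and the edges of the expanded amoebots is connected. In a round, first a set of bonds is released such that the structure stays connected. Then every amoebot either stays as it is, or expands (if contracted), or contracts (if expanded), or performs a handover with an amoebot to which it is bonded (a contracted amoebot takes over a node of an expanded one, which contracts to its other node). Amoebots are carried along: every remaining bond keeps its orientation, an expanding amoebot assigns each of its bonds to one of its two nodes, expanded amoebots that stay as they are keep their orientation, the nodes involved in a handover move by a common translation, and the result must again be a placement on the grid without double occupation. Then all bonds between adjacent amoebots are restored. Let $\mathrm{Arbitrary}$ be the class of connected structures of contracted amoebots, and $\mathrm{Bounded}(k)$ the class of those with at most $k$ non-empty $x$-, $y$-, or $z$-sections. Rows are $x$-sections, that is, the sets of amoebots with the same second coordinate. **Algorithm (Arbitrary2Bounded).** Given a structure with $n$ amoebots, repeat the following iteration until no rows can be paired. Choose a maximum set of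 disjoint pairs of adjacent non-empty rows $(r,r+1)$ such that each pair has a row with less than $\sqrt n$ amoebots; the choice among the maximum sets is arbitrary. Then merge all pairs in parallel: 1. *(1 round)* Each amoebot of a pair of rows expands into the other row of the pair parallel to the $y$-axis, if the node there is unoccupied. 2. While some pair of rows has a column with two contracted amoebots, perform a *tunneling step* (5 rounds), in parallel in all such pairs of rows. In each of them consider the rightmost such column and all expanded amoebots in the columns from there to the next unoccupied column to the right. Every second of these expanded amoebots contracts to its bottom node, with the rightmost one remaining expanded (1 round). The tunneling primitive is run on the chain that consists of the two contracted amoebots (the lower one is last in the chain, followed by the upper one) and these further amoebots (3 rounds): in each round, every contracted amoebot whose predecessor in the chain is expanded performs a handover with it, and the first amoebot, if contracted, expands along the path, which ends with the bottom and then the top node of the unoccupied column. Finally, all contracted amoebots of the chain expand upwards (1 round). 3. *(1 round)* All expanded amoebots contract, which merges every pair of rows into one row. **Lemma.** There is a constant $C>0$ such that for every $n$, every rule for choosing the maximum sets of pairs, and every structure $S\in\mathrm{Arbitrary}$ with $n$ amoebots, the algorithm can be executed from $S$ by valid rounds and terminates. It ends in a structure of $\mathrm{Bounded}(\sqrt n)$,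 in fact one with at most $\sqrt n$ non-empty rows. It performs at most $C\log n$ iterations, each with fewer than $\sqrt n$ tunneling steps (that is, at most $\lceil\sqrt n\rceil-1$). An iteration with $t$ tunneling steps takes $2+5t$ rounds, and the total number of rounds is at most $C\sqrt n\log n$. -/

import Mathlib

open Finset

namespace Amoebot

/-! ### The triangular grid -/

/-- Nodes of the triangular grid in axial coordinates: the first coordinate runs along the
`x`-axis, the second one along the `y`-axis, and the third axis has direction `(1, -1)`. -/
abbrev Node := ℤ × ℤ

/-- The infinite regular triangular grid graph: every node has six neighbours. -/
def grid : SimpleGraph Node where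
  Adj u v := v - u = (1, 0) ∨ v - u = (-1, 0) ∨ v - u = (0, 1) ∨ v - u = (0, -1) ∨
    v - u = (1, -1) ∨ v - u = (-1, 1)
  symm := ⟨by
    rintro ⟨a, b⟩ ⟨c, d⟩ h
    simp only [Prod.mk_sub_mk, Prod.mk.injEq] at h ⊢
    omega⟩
  loopless := ⟨by
    rintro ⟨a, b⟩ h
    simp only [Prod.mk_sub_mk, Prod.mk.injEq] at h
    omega⟩

/-! ### Amoebot structures -/

/-- An amoebot structure with amoebots `ι` placed on the grid: every amoebot occupies one node
(`tail i = head i`) or two adjacent nodes, and every node is occupied by at most one amoebot.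
The order of the two nodes of an expanded amoebot has no meaning in the model. -/
@[ext]
structure Config (ι : Type) where
  tail : ι → Node
  head : ι → Node
  edge : ∀ i, tail i = head i ∨ grid.Adj (tail i) (head i)
  disj : ∀ i j, i ≠ j → Disjoint ({tail i, head i} : Set Node) {tail j, head j}

namespace Config

variable {ι : Type}

/-- The nodes occupied by amoebot `i`. -/
def nodes (S : Config ι) (i : ι) : Set Node := {S.tail i, S.head i}

/-- All occupied nodes. -/
def occupied (S : Config ι) : Set Node := {v | ∃ i, v ∈ S.nodes i}

/-- Amoebot `i` is contracted. -/
def Contracted (S : Config ι) (i : ι) : Prop := S.tail i = S.head i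

/-- Amoebot `i` is contracted and occupies the node `v`. -/
def ContractedAt (S : Config ι) (i : ι) (v : Node) : Prop := S.tail i = v ∧ S.head i = v

/-- The edges occupied by expanded amoebots. -/
def bodyGraph (S : Config ι) : SimpleGraph Node where
  Adj u v := u ≠ v ∧ ∃ i, u ∈ S.nodes i ∧ v ∈ S.nodes i
  symm := ⟨fun _ _ h => ⟨h.1.symm, h.2.imp fun _ hi => ⟨hi.2, hi.1⟩⟩⟩
  loopless := ⟨fun _ h => h.1 rfl⟩

/-- The bonds: all grid edges between nodes that are occupied by different amoebots. -/
def bondGraph (S : Config ι) : SimpleGraph Node where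
  Adj u v := grid.Adj u v ∧ ∃ i j, i ≠ j ∧ u ∈ S.nodes i ∧ v ∈ S.nodes j
  symm := ⟨fun _ _ h => ⟨h.1.symm, by
    obtain ⟨i, j, hij, hu, hv⟩ := h.2
    exact ⟨j, i, hij.symm, hv, hu⟩⟩⟩
  loopless := ⟨fun _ h => h.1.ne rfl⟩

/-- The structure is connected when `R` is its set of bonds. -/
def ConnectedBy (S : Config ι) (R : SimpleGraph Node) : Prop :=
  ∀ u ∈ S.occupied, ∀ v ∈ S.occupied, (S.bodyGraph ⊔ R).Reachable u v

end Config

/-! ### Rounds -/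

/-- The movement of an amoebot in one round. -/
inductive Action (ι : Type) where
  | idle
  | expand
  | contract
  | handover (j : ι)

variable {ι : Type}

/-- The contracted amoebot `c` and the expanded amoebot `x`, occupying `x₁` and `x₂` and
connected to `c` by the remaining bond from the node of `c` to `x₁`, perform a handover:
`c` takes over the node `x₁`. The three nodes together with all bonds at them move by a common
translation `t`. Here `pos u v` is the new position of the endpoint `u` of a remaining bond
between `u` and `v`. -/
def Handover (S S' : Config ι) (R : SimpleGraph Node) (pos : Node → Node → Node) (c x : ι) :
    Prop :=
  ∃ x₁ x₂ t : Node, S.Contracted c ∧ x₁ ≠ x₂ ∧ S.nodes x = {x₁, x₂} ∧ R.Adj (S.tail c) x₁ ∧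
    S'.nodes c = {S.tail c + t, x₁ + t} ∧ S'.nodes x = {x₂ + t} ∧
    ∀ u ∈ ({S.tail c, x₁, x₂} : Set Node), ∀ v, R.Adj u v → pos u v = u + t

/-- `S'` results from `S` by one round in which amoebot `i` performs the movement `act i`.
First, bonds are released such that a set `R` of bonds remains and the structure stays connected.
Then all amoebots move; the endpoints of the remaining bonds are moved by `pos` (`pos u v` is the
new position of the endpoint `u` of a bond between `u` and `v`) and every remaining bond keeps its
orientation. An amoebot without movement is only translated, an expanding amoebot attaches each of
its bonds to one of its two new nodes, and a contracting amoebot attaches all its bonds to its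
single new node. The absence of collisions is part of `S'` being a `Config`. -/
def RoundBy (act : ι → Action ι) (S S' : Config ι) : Prop :=
  ∃ (R : SimpleGraph Node) (pos : Node → Node → Node),
    R ≤ S.bondGraph ∧
    S.ConnectedBy R ∧
    (∀ u v, R.Adj u v → pos v u - pos u v = v - u) ∧
    (∀ i, act i = .idle →
      ∃ t : Node, S'.tail i = S.tail i + t ∧ S'.head i = S.head i + t ∧
        ∀ u ∈ S.nodes i, ∀ v, R.Adj u v → pos u v = u + t) ∧
    (∀ i, act i = .expand →
      S.Contracted i ∧ ¬ S'.Contracted i ∧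
        ∀ u ∈ S.nodes i, ∀ v, R.Adj u v → pos u v ∈ S'.nodes i) ∧
    (∀ i, act i = .contract →
      ¬ S.Contracted i ∧ S'.Contracted i ∧
        ∀ u ∈ S.nodes i, ∀ v, R.Adj u v → pos u v ∈ S'.nodes i) ∧
    (∀ i j, act i = .handover j →
      act j = .handover i ∧ (Handover S S' R pos i j ∨ Handover S S' R pos j i))

/-- `S'` results from `S` by one round. -/
def Round (S S' : Config ι) : Prop := ∃ act : ι → Action ι, RoundBy act S S'

/-- Some schedule of exactly `T` rounds reconfigures `S` into `S'`. -/
def ReconfiguresIn (S S' : Config ι) (T : ℕ) : Prop :=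
  ∃ U : ℕ → Config ι, U 0 = S ∧ U T = S' ∧ ∀ s < T, Round (U s) (U (s + 1))

/-! ### Classes of structures -/

/-- The class of all (connected) structures that consist of contracted amoebots. -/
def Arbitrary (ι : Type) : Set (Config ι) :=
  {S | (∀ i, S.Contracted i) ∧ S.ConnectedBy S.bondGraph}

/-- The number of non-empty `x`-sections (rows). -/
noncomputable def numRows (S : Config ι) : ℕ := ((fun v : Node => v.2) '' S.occupied).ncard

/-- The number of non-empty `y`-sections (columns). -/
noncomputable def numColumns (S : Config ι) : ℕ := ((fun v : Node => v.1) '' S.occupied).ncard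

/-- The number of non-empty `z`-sections. -/
noncomputable def numZSections (S : Config ι) : ℕ :=
  ((fun v : Node => v.1 + v.2) '' S.occupied).ncard

/-- The structures with at most `k` non-empty `x`-, `y`-, or `z`-sections. -/
def Bounded (ι : Type) (k : ℝ) : Set (Config ι) :=
  {S | S ∈ Arbitrary ι ∧
    ((numRows S : ℝ) ≤ k ∨ (numColumns S : ℝ) ≤ k ∨ (numZSections S : ℝ) ≤ k)}

/-! ### Pairing rows -/

/-- The number of amoebots in row `r`. -/
noncomputable def rowCount (S : Config ι) (r : ℤ) : ℕ := {i | ∃ v ∈ S.nodes i, v.2 = r}.ncard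

/-- `P` is the set of lower rows of a pairing of adjacent non-empty rows (row `r` with row `r + 1`
for `r ∈ P`) in which every pair has a row with less than `√n` amoebots. -/
def IsPairing {n : ℕ} (S : Config (Fin n)) (P : Finset ℤ) : Prop :=
  ∀ r ∈ P, r + 1 ∉ P ∧ 0 < rowCount S r ∧ 0 < rowCount S (r + 1) ∧
    ((rowCount S r : ℝ) < √n ∨ (rowCount S (r + 1) : ℝ) < √n)

/-- A pairing with a maximum number of pairs. -/
def IsMaximumPairing {n : ℕ} (S : Config (Fin n)) (P : Finset ℤ) : Prop :=
  IsPairing S P ∧ ∀ Q, IsPairing S Q → Q.card ≤ P.card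

/-! ### Merging the pairs of rows -/

/-- Amoebot `i` performs the movement `a` and then has tail `u` and head `v`. -/
def Performs (act : ι → Action ι) (S' : Config ι) (i : ι) (a : Action ι) (u v : Node) : Prop :=
  act i = a ∧ S'.tail i = u ∧ S'.head i = v

/-- Amoebot `i` neither moves nor is moved. -/
def Rests (act : ι → Action ι) (S S' : Config ι) (i : ι) : Prop :=
  Performs act S' i .idle (S.tail i) (S.head i)

/-- Amoebot `i` of a lower row in `P` has an unoccupied node above it (along the `y`-axis). -/
def FreeAbove (P : Finset ℤ) (S : Config ι) (i : ι) : Prop :=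
  (S.tail i).2 ∈ P ∧ S.tail i + (0, 1) ∉ S.occupied

/-- Amoebot `i` of an upper row of a pair has an unoccupied node below it (along the `y`-axis). -/
def FreeBelow (P : Finset ℤ) (S : Config ι) (i : ι) : Prop :=
  (S.tail i).2 - 1 ∈ P ∧ S.tail i - (0, 1) ∉ S.occupied

/-- First phase (one round): each amoebot of a pair of rows expands into the other row parallel to
the `y`-axis if the node there is unoccupied. -/
def ExpandPhase (P : Finset ℤ) (S S' : Config ι) : Prop :=
  ∃ act, RoundBy act S S' ∧ ∀ i,
    (FreeAbove P S i → Performs act S' i .expand (S.tail i) (S.tail i + (0, 1))) ∧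
    (FreeBelow P S i → Performs act S' i .expand (S.tail i - (0, 1)) (S.tail i)) ∧
    (¬ FreeAbove P S i → ¬ FreeBelow P S i → Rests act S S' i)

/-- In column `c`, the rows `r` and `r + 1` hold a pair of contracted amoebots. -/
def IsPairColumn (S : Config ι) (r c : ℤ) : Prop :=
  ∃ i j, S.ContractedAt i (c, r) ∧ S.ContractedAt j (c, r + 1)

/-- The lower rows of those pairs of rows that still hold a pair of contracted amoebots. -/
def activeRows (P : Finset ℤ) (S : Config ι) : Set ℤ := {r | r ∈ P ∧ ∃ c, IsPairColumn S r c}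

/-- A chain in a pair of rows: it starts in column `col` and consists of the `len + 2` amoebots
`link 0` (the last one), …, `link (len + 1)` (the first one). -/
structure Chain (ι : Type) where
  col : ℤ
  len : ℕ
  link : ℕ → ι

/-- `ch` consists of the rightmost pair of contracted amoebots in the rows `r` and `r + 1` and of
the expanded amoebots in the columns from there to the next unoccupied column to the right. -/
def IsChain (S : Config ι) (r : ℤ) (ch : Chain ι) : Prop :=
  S.ContractedAt (ch.link 0) (ch.col, r) ∧
  S.ContractedAt (ch.link 1) (ch.col, r + 1) ∧
  (∀ c, ch.col < c → ¬ IsPairColumn S r c) ∧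
  (∀ j < ch.len, S.tail (ch.link (j + 2)) = (ch.col + j + 1, r) ∧
    S.head (ch.link (j + 2)) = (ch.col + j + 1, r + 1)) ∧
  (ch.col + ch.len + 1, r) ∉ S.occupied ∧ (ch.col + ch.len + 1, r + 1) ∉ S.occupied

/-- Amoebot `i` belongs to every second of the expanded amoebots of a chain, counted such that the
rightmost one does not. -/
def IsAlternate (A : Set ℤ) (ch : ℤ → Chain ι) (i : ι) : Prop :=
  ∃ r ∈ A, ∃ j < (ch r).len, Odd ((ch r).len - (j + 1)) ∧ i = (ch r).link (j + 2)

/-- One round that makes all chains alternating: every second expanded amoebot contracts to its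
bottom node. -/
def AlternateRound (A : Set ℤ) (ch : ℤ → Chain ι) (S S' : Config ι) : Prop :=
  ∃ act, RoundBy act S S' ∧ ∀ i,
    (IsAlternate A ch i → Performs act S' i .contract (S.tail i) (S.tail i)) ∧
    (¬ IsAlternate A ch i → Rests act S S' i)

/-- Amoebot `i`, contracted, directly follows the expanded amoebot `p` in a chain. -/
def Follows (A : Set ℤ) (ch : ℤ → Chain ι) (S : Config ι) (i p : ι) : Prop :=
  ∃ r ∈ A, ∃ j ≤ (ch r).len, i = (ch r).link j ∧ p = (ch r).link (j + 1) ∧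
    S.Contracted i ∧ ¬ S.Contracted p

/-- Amoebot `i` is the first one of a chain, it is contracted, and `v` is the next node on the
path of the chain, which leads to the bottom node and then to the top node of the unoccupied column
to the right of the chain. -/
def Leads (A : Set ℤ) (ch : ℤ → Chain ι) (S : Config ι) (i : ι) (v : Node) : Prop :=
  ∃ r ∈ A, i = (ch r).link ((ch r).len + 1) ∧ S.Contracted i ∧
    ((S.head i ≠ ((ch r).col + (ch r).len + 1, r) ∧ v = ((ch r).col + (ch r).len + 1, r)) ∨
     (S.head i = ((ch r).col + (ch r).len + 1, r) ∧ v = ((ch r).col + (ch r).len + 1, r + 1)))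

/-- One round of the tunneling primitive on all chains: contracted amoebots perform a handover with
their predecessor if that one is expanded, and a contracted first amoebot expands along the path.
The last amoebot, once expanded, keeps its nodes. -/
def TunnelRound (A : Set ℤ) (ch : ℤ → Chain ι) (S S' : Config ι) : Prop :=
  ∃ act, RoundBy act S S' ∧
    (∀ i p, Follows A ch S i p →
      Performs act S' i (.handover p) (S.tail i) (S.tail p) ∧
      Performs act S' p (.handover i) (S.head p) (S.head p)) ∧
    (∀ i v, Leads A ch S i v → Performs act S' i .expand (S.tail i) v) ∧
    ∀ i, (∀ p, ¬ Follows A ch S i p) → (∀ p, ¬ Follows A ch S p i) → (∀ v, ¬ Leads A ch S i v) →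
      Rests act S S' i

/-- Amoebot `i` is a contracted amoebot of a chain. -/
def IsContractedInChain (A : Set ℤ) (ch : ℤ → Chain ι) (S : Config ι) (i : ι) : Prop :=
  S.Contracted i ∧ ∃ r ∈ A, ∃ j ≤ (ch r).len + 1, i = (ch r).link j

/-- One round in which all contracted amoebots of the chains expand upwards. -/
def ReexpandRound (A : Set ℤ) (ch : ℤ → Chain ι) (S S' : Config ι) : Prop :=
  ∃ act, RoundBy act S S' ∧ ∀ i,
    (IsContractedInChain A ch S i →
      Performs act S' i .expand (S.tail i) (S.tail i + (0, 1))) ∧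
    (¬ IsContractedInChain A ch S i → Rests act S S' i)

/-- One tunneling step of the second phase (five rounds), performed in parallel in all pairs of
rows that still hold a pair of contracted amoebots: the chains are made alternating, the tunneling
primitive runs for three rounds, and the contracted amoebots of the chains expand again. -/
def TunnelStep (P : Finset ℤ) (S S' : Config ι) : Prop :=
  ∃ ch : ℤ → Chain ι, (∀ r ∈ activeRows P S, IsChain S r (ch r)) ∧
    ∃ S₁ S₂ S₃ S₄ : Config ι,
      AlternateRound (activeRows P S) ch S S₁ ∧
      TunnelRound (activeRows P S) ch S₁ S₂ ∧
      TunnelRound (activeRows P S) ch S₂ S₃ ∧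
      TunnelRound (activeRows P S) ch S₃ S₄ ∧
      ReexpandRound (activeRows P S) ch S₄ S'

/-- The new position of a node when the rows `r` and `r + 1` are merged for every `r ∈ P`. -/
def collapse (P : Finset ℤ) (v : Node) : Node := (v.1, v.2 - (P.filter (· < v.2)).card)

/-- Third phase (one round): all expanded amoebots contract, which merges the pairs of rows. -/
def ContractPhase (P : Finset ℤ) (S S' : Config ι) : Prop :=
  ∃ act, RoundBy act S S' ∧ ∀ i,
    (¬ S.Contracted i →
      Performs act S' i .contract (collapse P (S.tail i)) (collapse P (S.head i))) ∧
    (S.Contracted i →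
      Performs act S' i .idle (collapse P (S.tail i)) (collapse P (S.head i)))

/-- One iteration of the Arbitrary2Bounded algorithm, which merges the pairs of rows given by `P`
and needs `t` tunneling steps; it consists of `1 + 5 * t + 1` rounds. -/
def Iteration (P : Finset ℤ) (t : ℕ) (S S' : Config ι) : Prop :=
  ∃ U : ℕ → Config ι,
    ExpandPhase P S (U 0) ∧
    (∀ s < t, (activeRows P (U s)).Nonempty ∧ TunnelStep P (U s) (U (s + 1))) ∧
    activeRows P (U t) = ∅ ∧
    ContractPhase P (U t) S'

end Amoebot

namespace Amoebot

variable {ι : Type}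

/-! ### Connected sets of nodes -/

/-! The proof has a geometric half (every iteration is a sequence of valid rounds) and a counting
half (few iterations suffice). Geometry. Bonds and bodies together are exactly the grid edges
between occupied nodes, so connectivity depends only on the occupied set. All rounds but the last
one of an iteration can be executed without displacing anything, and then validity reduces to
connectivity of one occupied set (`roundBy_of_static`, `roundBy_of_shrink`). A chain with `l`
expanded amoebots lives on a zigzag path through two rows, so its configurations are described by
path positions. After every second amoebot has contracted, three rounds shift all links, whatever
`l` is, because links of alternating parity move in parallel (`tunnels_first`, `tunnels_second`,
`tunnels_third`). Meanwhile only isolated top nodes of the original path can be vacated, and each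
can be bypassed through its remaining neighbours (`GridConnected.diff`,
`ChainSystem.gridConnected`). A step fills the free column and turns one column of two contracted
amoebots into an expanded amoebot, so the number of steps is at most the number of such columns,
which is at most the size of the smaller row, hence below `√n`. In the final contraction only the
bonds whose orientation survives the merge are kept; the expanded bodies replace the others.
Counting. Call a non-empty row small if it has less than `√n` amoebots. Merging a pair removes at
least one small row (`card_smallRows_add_card_le`). By maximality and connectivity every small row
lies in or next to a pair, so there are at most four small rows per pair (`card_smallRows_le`).
Hence each iteration leaves at most 3/4 of the small rows, which gives logarithmically many
iterations. If nothing can be paired and there are at least two rows, every row has a neighbouring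
row and so at least `√n` amoebots; thus there are at most `√n` rows. -/

lemma grid_adj_iff {a b c d : ℤ} : grid.Adj (a, b) (c, d) ↔
    (c = a + 1 ∧ d = b) ∨ (c = a - 1 ∧ d = b) ∨ (c = a ∧ d = b + 1) ∨ (c = a ∧ d = b - 1) ∨
    (c = a + 1 ∧ d = b - 1) ∨ (c = a - 1 ∧ d = b + 1) := by
  simp only [grid, Prod.mk_sub_mk, Prod.mk.injEq]
  omega

/-- The grid edges between nodes of `O`. -/
def gridOn (O : Set Node) : SimpleGraph Node where
  Adj u v := grid.Adj u v ∧ u ∈ O ∧ v ∈ O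
  symm := ⟨fun _ _ h => ⟨h.1.symm, h.2.2, h.2.1⟩⟩
  loopless := ⟨fun _ h => h.1.ne rfl⟩

/-- The nodes of `O` are connected by grid edges between nodes of `O`. -/
def GridConnected (O : Set Node) : Prop := ∀ u ∈ O, ∀ v ∈ O, (gridOn O).Reachable u v

lemma reachable_map {G H : SimpleGraph Node} (f : Node → Node)
    (h : ∀ u v, G.Adj u v → H.Reachable (f u) (f v)) {u v : Node} (huv : G.Reachable u v) :
    H.Reachable (f u) (f v) := by
  obtain ⟨w⟩ := huv
  induction w with
  | nil => exact .rfl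
  | cons e _ ih => exact (h _ _ e).trans ih

lemma reachable_of_adj_reachable {G H : SimpleGraph Node}
    (h : ∀ u v, G.Adj u v → H.Reachable u v) {u v : Node} (huv : G.Reachable u v) :
    H.Reachable u v :=
  reachable_map id h huv

lemma gridOn_mono {O O' : Set Node} (h : O ⊆ O') : gridOn O ≤ gridOn O' :=
  fun _ _ e => ⟨e.1, h e.2.1, h e.2.2⟩

lemma GridConnected.of_subset {O O' : Set Node} (hO : GridConnected O) (hsub : O ⊆ O')
    (h : ∀ v ∈ O', v ∈ O ∨ ∃ w ∈ O, grid.Adj v w) : GridConnected O' := by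
  have key : ∀ v ∈ O', ∃ w ∈ O, (gridOn O').Reachable v w := by
    intro v hv
    obtain hv' | ⟨w, hw, hvw⟩ := h v hv
    · exact ⟨v, hv', .rfl⟩
    · exact ⟨w, hw, SimpleGraph.Adj.reachable ⟨hvw, hv, hsub hw⟩⟩
  intro u hu v hv
  obtain ⟨u', hu', huu⟩ := key u hu
  obtain ⟨v', hv', hvv⟩ := key v hv
  exact huu.trans (((hO u' hu' v' hv').mono (gridOn_mono hsub)).trans hvv.symm)

lemma GridConnected.image {O : Set Node} (hO : GridConnected O) (f : Node → Node)
    (h : ∀ u ∈ O, ∀ v ∈ O, grid.Adj u v → f u = f v ∨ grid.Adj (f u) (f v)) :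
    GridConnected (f '' O) := by
  rintro _ ⟨u, hu, rfl⟩ _ ⟨v, hv, rfl⟩
  refine reachable_map f (fun x y e => ?_) (hO u hu v hv)
  obtain hxy | hxy := h x e.2.1 y e.2.2 e.1
  · rw [hxy]
  · exact SimpleGraph.Adj.reachable ⟨hxy, ⟨x, e.2.1, rfl⟩, ⟨y, e.2.2, rfl⟩⟩

/-- Removing nodes `(x, y)` whose neighbours `(x, y - 1)`, `(x + 1, y)`, `(x + 1, y - 1)`, and
`(x - 1, y)` remain does not disconnect, if no two nodes of adjacent rows above are removed. -/
lemma GridConnected.diff {O T : Set Node} (hO : GridConnected O)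
    (hT : ∀ x y, (x, y) ∈ T → (x, y - 1) ∈ O \ T ∧ (x + 1, y) ∈ O \ T ∧ (x + 1, y - 1) ∈ O \ T ∧
      (x - 1, y) ∈ O \ T ∧ (x, y + 1) ∉ T ∧ (x - 1, y + 1) ∉ T) : GridConnected (O \ T) := by
  classical
  -- Pushing each removed node down by one sends edges to connected pairs, so walks in `O` become
  -- walks in `O \ T`.
  let f : Node → Node := fun v => if v ∈ T then (v.1, v.2 - 1) else v
  have adj : ∀ {u v : Node}, u ∈ O \ T → v ∈ O \ T → grid.Adj u v →
      (gridOn (O \ T)).Reachable u v := fun hu hv e => SimpleGraph.Adj.reachable ⟨e, hu, hv⟩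
  have key : ∀ x y : ℤ, ∀ v : Node, (x, y) ∈ T → v ∈ O → grid.Adj (x, y) v →
      (gridOn (O \ T)).Reachable (x, y - 1) (f v) := by
    rintro x y ⟨c, d⟩ ht hv e
    obtain ⟨h1, h2, h3, h4, h5, h6⟩ := hT x y ht
    have r3 : (gridOn (O \ T)).Reachable (x, y - 1) (x + 1, y - 1) :=
      adj h1 h3 (grid_adj_iff.2 (by omega))
    have r2 : (gridOn (O \ T)).Reachable (x, y - 1) (x + 1, y) :=
      r3.trans (adj h3 h2 (grid_adj_iff.2 (by omega)))
    have r4 : (gridOn (O \ T)).Reachable (x, y - 1) (x - 1, y) :=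
      adj h1 h4 (grid_adj_iff.2 (by omega))
    have hf : ∀ w : Node, w ∉ T → f w = w := fun w hw => if_neg hw
    obtain ⟨rfl, rfl⟩ | ⟨rfl, rfl⟩ | ⟨rfl, rfl⟩ | ⟨rfl, rfl⟩ | ⟨rfl, rfl⟩ | ⟨rfl, rfl⟩ :=
      grid_adj_iff.1 e
    · rw [hf _ h2.2]; exact r2
    · rw [hf _ h4.2]; exact r4
    -- The two neighbours in the row above are reached around the removed node, through its right or
    -- left neighbour.
    · rw [hf _ h5]; exact r2.trans (adj h2 ⟨hv, h5⟩ (grid_adj_iff.2 (by omega)))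
    · rw [hf _ h1.2]
    · rw [hf _ h3.2]; exact r3
    · rw [hf _ h6]; exact r4.trans (adj h4 ⟨hv, h6⟩ (grid_adj_iff.2 (by omega)))
  have edge : ∀ u v, (gridOn O).Adj u v → (gridOn (O \ T)).Reachable (f u) (f v) := by
    rintro u v ⟨e, hu, hv⟩
    by_cases hut : u ∈ T
    · have := key u.1 u.2 v hut hv e
      rwa [show f u = (u.1, u.2 - 1) from if_pos hut]
    by_cases hvt : v ∈ T
    · have := key v.1 v.2 u hvt hu e.symm
      rw [show f v = (v.1, v.2 - 1) from if_pos hvt]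
      exact this.symm
    rw [show f u = u from if_neg hut, show f v = v from if_neg hvt]
    exact adj ⟨hu, hut⟩ ⟨hv, hvt⟩ e
  intro u hu v hv
  have := reachable_map f edge (hO u hu.1 v hv.1)
  rwa [show f u = u from if_neg hu.2, show f v = v from if_neg hv.2] at this

/-- In a connected set with more than one non-empty row, every non-empty row is adjacent to a
non-empty one. -/
lemma GridConnected.exists_adjacent_row {O : Set Node} (hO : GridConnected O) {u v : Node}
    (hu : u ∈ O) (hv : v ∈ O) (huv : v.2 ≠ u.2) :
    (∃ w ∈ O, w.2 = u.2 + 1) ∨ ∃ w ∈ O, w.2 + 1 = u.2 := by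
  by_contra! hcon
  obtain ⟨w⟩ := hO u hu v hv
  -- A walk to another row has an edge that leaves the row of `u`, and it can only lead to an
  -- adjacent row.
  obtain ⟨d, -, hd1, hd2⟩ := w.exists_boundary_dart {x | x.2 = u.2} rfl huv
  have hadj := d.adj
  obtain ⟨⟨a, b⟩, hd3⟩ : ∃ x, x = d.fst := ⟨_, rfl⟩
  obtain ⟨⟨a', b'⟩, hd4⟩ : ∃ x, x = d.snd := ⟨_, rfl⟩
  rw [← hd3, ← hd4] at hadj
  rw [← hd3] at hd1
  rw [← hd4] at hd2
  have h1 := hcon.1 _ hadj.2.2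
  have h2 := hcon.2 _ hadj.2.2
  have h3 := grid_adj_iff.1 hadj.1
  simp only [Set.mem_ofPred_eq] at hd1 hd2 h1 h2
  omega

/-! ### Occupied nodes -/

namespace Config

lemma eq_of_mem_nodes (S : Config ι) {i j : ι} {v : Node} (hi : v ∈ S.nodes i)
    (hj : v ∈ S.nodes j) : i = j := by
  by_contra hij
  exact Set.disjoint_left.1 (S.disj i j hij) hi hj

lemma tail_mem (S : Config ι) (i : ι) : S.tail i ∈ S.nodes i := Or.inl rfl

lemma Contracted.eq_tail {S : Config ι} {i : ι} (h : S.Contracted i) {v : Node}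
    (hv : v ∈ S.nodes i) : v = S.tail i := by
  obtain rfl | rfl := hv
  · rfl
  · exact Eq.symm h

lemma ContractedAt.contracted {S : Config ι} {i : ι} {v : Node} (h : S.ContractedAt i v) :
    S.Contracted i := h.1.trans h.2.symm

lemma ContractedAt.mem {S : Config ι} {i : ι} {v : Node} (h : S.ContractedAt i v) :
    v ∈ S.nodes i := Or.inl h.1.symm

lemma grid_adj_of_mem_nodes (S : Config ι) {i : ι} {u v : Node} (hu : u ∈ S.nodes i)
    (hv : v ∈ S.nodes i) (huv : u ≠ v) : grid.Adj u v := by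
  obtain h | h := S.edge i
  · obtain rfl | rfl := hu <;> obtain rfl | rfl := hv <;> simp_all
  · obtain rfl | rfl := hu <;> obtain rfl | rfl := hv
    · exact absurd rfl huv
    · exact h
    · exact h.symm
    · exact absurd rfl huv

/-- Adjacent occupied nodes belong to one amoebot or to two. Hence connectivity with all bonds is a
property of the occupied set alone. -/
lemma bodyGraph_sup_bondGraph (S : Config ι) :
    S.bodyGraph ⊔ S.bondGraph = gridOn S.occupied := by
  ext u v
  constructor
  · rintro (⟨huv, i, hu, hv⟩ | ⟨huv, i, j, -, hu, hv⟩)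
    · exact ⟨S.grid_adj_of_mem_nodes hu hv huv, ⟨i, hu⟩, ⟨i, hv⟩⟩
    · exact ⟨huv, ⟨i, hu⟩, ⟨j, hv⟩⟩
  · rintro ⟨huv, ⟨i, hu⟩, ⟨j, hv⟩⟩
    obtain rfl | hij := eq_or_ne i j
    · exact Or.inl ⟨huv.ne, i, hu, hv⟩
    · exact Or.inr ⟨huv, i, j, hij, hu, hv⟩

lemma connectedBy_bondGraph_iff (S : Config ι) :
    S.ConnectedBy S.bondGraph ↔ GridConnected S.occupied := by
  rw [ConnectedBy, bodyGraph_sup_bondGraph, GridConnected]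

end Config

/-! ### Rounds that do not displace nodes -/

/-- The contracted amoebot `c` takes over the tail of `x`, without a displacement. -/
def StaticHandover (S S' : Config ι) (c x : ι) : Prop :=
  S.Contracted c ∧ ¬ S.Contracted x ∧ grid.Adj (S.tail c) (S.tail x) ∧
    S'.nodes c = {S.tail c, S.tail x} ∧ S'.nodes x = {S.head x}

/-- No bond is released and no bond endpoint moves, so orientations are kept trivially, and
connectivity is needed only before the round. Contractions are excluded because bonds at an
abandoned node would have to move. -/
lemma roundBy_of_static {S S' : Config ι} {act : ι → Action ι} (hS : GridConnected S.occupied)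
    (hidle : ∀ i, act i = .idle → S'.tail i = S.tail i ∧ S'.head i = S.head i)
    (hexp : ∀ i, act i = .expand → S.Contracted i ∧ ¬ S'.Contracted i ∧ S.tail i ∈ S'.nodes i)
    (hcon : ∀ i, act i ≠ .contract)
    (hhand : ∀ i j, act i = .handover j →
      act j = .handover i ∧ (StaticHandover S S' i j ∨ StaticHandover S S' j i)) :
    RoundBy act S S' := by
  have hh : ∀ c x, StaticHandover S S' c x → Handover S S' S.bondGraph (fun u _ => u) c x := by
    rintro c x ⟨h1, h2, h3, h4, h5⟩
    refine ⟨S.tail x, S.head x, 0, h1, h2, rfl,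
      ⟨h3, c, x, ?_, S.tail_mem c, S.tail_mem x⟩, by simpa using h4, by simpa using h5, by simp⟩
    rintro rfl
    exact h2 h1
  refine ⟨S.bondGraph, fun u _ => u, le_rfl, S.connectedBy_bondGraph_iff.2 hS, fun _ _ _ => rfl,
    fun i hi => ⟨0, by simp [hidle i hi]⟩, fun i hi => ?_, fun i hi => absurd hi (hcon i),
    fun i j hij => ⟨(hhand i j hij).1, (hhand i j hij).2.imp (hh i j) (hh j i)⟩⟩
  obtain ⟨h1, h2, h3⟩ := hexp i hi
  exact ⟨h1, h2, fun u hu v _ => by rwa [h1.eq_tail hu]⟩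

/-- A round in which amoebots only contract, to their tails, without a displacement. -/
lemma roundBy_of_shrink {S S' : Config ι} {act : ι → Action ι} (hS : GridConnected S'.occupied)
    (hidle : ∀ i, act i = .idle → S'.tail i = S.tail i ∧ S'.head i = S.head i)
    (hcon : ∀ i, act i = .contract → ¬ S.Contracted i ∧ S'.tail i = S.tail i ∧
      S'.head i = S.tail i)
    (hact : ∀ i, act i = .idle ∨ act i = .contract) :
    RoundBy act S S' := by
  have htail : ∀ i, S'.tail i = S.tail i := fun i =>
    (hact i).elim (fun h => (hidle i h).1) fun h => (hcon i h).2.1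
  have hsub : ∀ i, S'.nodes i ⊆ S.nodes i := by
    intro i v hv
    obtain h | h := hact i
    · simpa only [Config.nodes, hidle i h] using hv
    · simp only [Config.nodes, (hcon i h).2] at hv
      exact Or.inl (by simpa using hv)
  have hocc : S'.occupied ⊆ S.occupied := fun v ⟨i, hi⟩ => ⟨i, hsub i hi⟩
  -- All bonds at abandoned nodes are released; such a node stays connected through the body of its
  -- amoebot.
  let R : SimpleGraph Node := S.bondGraph ⊓ gridOn S'.occupied
  have hle : gridOn S'.occupied ≤ S.bodyGraph ⊔ R := by
    intro u v huv
    have := gridOn_mono hocc huv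
    rw [← S.bodyGraph_sup_bondGraph] at this
    exact this.imp id fun h => ⟨h, huv⟩
  have hret : ∀ u ∈ S.occupied, ∃ u' ∈ S'.occupied, (S.bodyGraph ⊔ R).Reachable u u' := by
    rintro u ⟨i, hi⟩
    refine ⟨S.tail i, ⟨i, htail i ▸ S'.tail_mem i⟩, ?_⟩
    obtain rfl | hne := eq_or_ne u (S.tail i)
    · exact .rfl
    · exact SimpleGraph.Adj.reachable (Or.inl ⟨hne, i, hi, S.tail_mem i⟩)
  refine ⟨R, fun u _ => u, inf_le_left, ?_, fun _ _ _ => rfl,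
    fun i hi => ⟨0, by simp [hidle i hi]⟩, fun i hi => ?_, fun i hi => ?_, fun i j hi => ?_⟩
  · intro u hu v hv
    obtain ⟨u', hu', huu⟩ := hret u hu
    obtain ⟨v', hv', hvv⟩ := hret v hv
    exact huu.trans (((hS u' hu' v' hv').mono hle).trans hvv.symm)
  · obtain h | h := hact i <;> simp [h] at hi
  · obtain ⟨h1, h2, h3⟩ := hcon i hi
    refine ⟨h1, h2.trans h3.symm, fun u hu v huv => ?_⟩
    -- A remaining bond ends at a node that survives the contraction, so it need not move.
    obtain ⟨j, hj⟩ := huv.2.2.1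
    obtain rfl := S.eq_of_mem_nodes (hsub j hj) hu
    exact hj
  · obtain h | h := hact i <;> simp [h] at hi

/-! ### Schedules -/

lemma ReconfiguresIn.trans {S S' S'' : Config ι} {T T' : ℕ} (h : ReconfiguresIn S S' T)
    (h' : ReconfiguresIn S' S'' T') : ReconfiguresIn S S'' (T + T') := by
  obtain ⟨U, h0, hT, hU⟩ := h
  obtain ⟨U', h0', hT', hU'⟩ := h'
  refine ⟨fun s => if s ≤ T then U s else U' (s - T), by simp [h0], ?_, fun s hs => ?_⟩
  · obtain rfl | hpos := Nat.eq_zero_or_pos T'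
    · simp [hT, ← h0', hT']
    · simp [hpos.ne', hT']
  · obtain hlt | rfl | hgt := lt_trichotomy s T
    · simpa [hlt.le, Nat.succ_le_of_lt hlt] using hU s hlt
    · simpa [hT, ← h0'] using hU' 0 (by omega)
    · have h1 : ¬ s ≤ T := by omega
      have h2 : ¬ s + 1 ≤ T := by omega
      simpa [h1, h2, show s + 1 - T = s - T + 1 by omega] using hU' (s - T) (by omega)

lemma ReconfiguresIn.refl (S : Config ι) : ReconfiguresIn S S 0 :=
  ⟨fun _ => S, rfl, rfl, by simp⟩

lemma Round.reconfiguresIn {S S' : Config ι} (h : Round S S') : ReconfiguresIn S S' 1 :=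
  ⟨fun s => if s = 0 then S else S', by simp, by simp, fun s hs => by
    obtain rfl : s = 0 := by omega
    simpa using h⟩

lemma ReconfiguresIn.iterate {U : ℕ → Config ι} {T : ℕ → ℕ} {K : ℕ}
    (h : ∀ k < K, ReconfiguresIn (U k) (U (k + 1)) (T k)) :
    ReconfiguresIn (U 0) (U K) (∑ k ∈ range K, T k) := by
  induction K with
  | zero => exact .refl _
  | succ K ih =>
    rw [sum_range_succ]
    exact (ih fun k hk => h k (by omega)).trans (h K (by omega))

lemma TunnelStep.reconfiguresIn {P : Finset ℤ} {S S' : Config ι} (h : TunnelStep P S S') :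
    ReconfiguresIn S S' 5 := by
  obtain ⟨_, -, _, _, _, _, ⟨_, h1, -⟩, ⟨_, h2, -⟩, ⟨_, h3, -⟩, ⟨_, h4, -⟩, ⟨_, h5, -⟩⟩ := h
  have r : ∀ {S S' : Config ι} {act}, RoundBy act S S' → ReconfiguresIn S S' 1 :=
    fun h => Round.reconfiguresIn ⟨_, h⟩
  exact ((((r h1).trans (r h2)).trans (r h3)).trans (r h4)).trans (r h5)

lemma Iteration.reconfiguresIn {P : Finset ℤ} {t : ℕ} {S S' : Config ι}
    (h : Iteration P t S S') : ReconfiguresIn S S' (1 + 5 * t + 1) := by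
  obtain ⟨U, ⟨_, h1, -⟩, h2, -, ⟨_, h3, -⟩⟩ := h
  have h4 := ReconfiguresIn.iterate (T := fun _ => 5) fun s hs => (h2 s hs).2.reconfiguresIn
  rw [sum_const, card_range, smul_eq_mul, mul_comm] at h4
  exact ((Round.reconfiguresIn ⟨_, h1⟩).trans h4).trans (Round.reconfiguresIn ⟨_, h3⟩)

/-! ### Positions along the path of a chain -/

/-- The `k`-th node of the path that starts in column `c` and runs through the rows `r` and `r + 1`,
column by column from bottom to top. -/
def pathNode (r c : ℤ) (k : ℕ) : Node := (c + (k / 2 : ℕ), r + (k % 2 : ℕ))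

/-- One step along the path is `(0, 1)` or `(1, -1)`, two steps are `(1, 0)`. -/
lemma pathNode_adj {r c : ℤ} {k k' : ℕ} (h : k < k') (h' : k' ≤ k + 2) :
    grid.Adj (pathNode r c k) (pathNode r c k') := by
  simp only [pathNode, grid_adj_iff]
  omega

/-- The top nodes that are unoccupied while a chain with `l` expanded amoebots tunnels. -/
def IsHole (l k : ℕ) : Prop := 3 ≤ k ∧ k % 2 = 1 ∧ (l + k / 2) % 2 = 1

/-- The link `m` of a chain with `l` expanded amoebots has its tail at the node `a l m` of the path
and its head at the node `b l m`. All these nodes are distinct for different links, and cover the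
path up to the holes. -/
structure Placement (a b : ℕ → ℕ → ℕ) : Prop where
  le : ∀ l m, m ≤ l + 1 → a l m ≤ b l m ∧ b l m ≤ a l m + 2 ∧ b l m ≤ 2 * l + 3
  lt : ∀ l m, m ≤ l → b l m < a l (m + 1)
  covers : ∀ l k, k ≤ 2 * l + 1 → ¬ IsHole l k → ∃ m ≤ l + 1, k = a l m ∨ k = b l m

lemma Placement.lt_of_lt {a b : ℕ → ℕ → ℕ} (h : Placement a b) {l m m' : ℕ} (hm : m < m')
    (hm' : m' ≤ l + 1) : b l m < a l m' := by
  induction m', hm using Nat.le_induction with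
  | base => exact h.lt l m (by omega)
  | succ k hk ih =>
    have h1 := ih (by omega)
    have h2 := h.lt l k (by omega)
    have h3 := h.le l k (by omega)
    omega

/-- The positions of the tails of a chain when it is formed. -/
def startTail (_ m : ℕ) : ℕ := if m ≤ 1 then m else 2 * m - 2

/-- The positions of the heads that belong to `startTail`. -/
def startHead (_ m : ℕ) : ℕ := if m ≤ 1 then m else 2 * m - 1

/-- The positions of the heads of an alternating chain, with the tails `startTail`. -/
def alternateHead (l m : ℕ) : ℕ :=
  if m ≤ 1 then m else if (l + m) % 2 = 0 then 2 * m - 2 else 2 * m - 1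

/-- The positions of the tails of a chain after the first round of the tunneling primitive. -/
def firstTail (l m : ℕ) : ℕ :=
  if m ≤ 1 then m else if (l + m) % 2 = 0 then 2 * m - 2 else 2 * m - 1

/-- The positions of the heads that belong to `firstTail`. -/
def firstHead (l m : ℕ) : ℕ :=
  if m = 0 then 0 else if l = 0 ∨ (l + m) % 2 = 0 then 2 * m else 2 * m - 1

/-- The positions of the tails of a chain after the second round of the tunneling primitive. -/
def secondTail (l m : ℕ) : ℕ :=
  if l = 0 ∨ (l + m) % 2 = 0 then 2 * m else 2 * m - 1

/-- The positions of the heads that belong to `secondTail`. -/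
def secondHead (l m : ℕ) : ℕ :=
  if m = 0 ∧ (l = 0 ∨ l % 2 = 1) then 1 else 2 * m

/-- The positions of the tails of a chain after the third round of the tunneling primitive. -/
def thirdTail (_ m : ℕ) : ℕ := 2 * m

/-- The positions of the heads that belong to `thirdTail`. -/
def thirdHead (l m : ℕ) : ℕ :=
  if m ≠ 0 ∧ l ≠ 0 ∧ (l + m) % 2 = 1 then 2 * m else 2 * m + 1

/-- The positions of the heads at the end of the tunneling step, with the tails `thirdTail`. -/
def finalHead (_ m : ℕ) : ℕ := 2 * m + 1

lemma placement_alternate : Placement startTail alternateHead where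
  le l m hm := by unfold startTail alternateHead; split_ifs <;> omega
  lt l m hm := by unfold startTail alternateHead; split_ifs <;> omega
  covers l k hk hh := by
    -- The pair of contracted links shares column 0, so the link in column `k / 2 > 0` has index `k
    -- / 2 + 1`.
    refine ⟨if k ≤ 1 then k else k / 2 + 1, ?_⟩
    unfold IsHole at hh
    unfold startTail alternateHead
    split_ifs <;> omega

lemma placement_first : Placement firstTail firstHead where
  le l m hm := by unfold firstTail firstHead; split_ifs <;> omega
  lt l m hm := by unfold firstTail firstHead; split_ifs <;> omega
  covers l k hk hh := by
    refine ⟨if k ≤ 1 then k else if k % 2 = 0 ∧ (l + k / 2) % 2 = 0 then k / 2 else k / 2 + 1, ?_⟩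
    unfold IsHole at hh
    unfold firstTail firstHead
    split_ifs <;> omega

lemma placement_second : Placement secondTail secondHead where
  le l m hm := by unfold secondTail secondHead; split_ifs <;> omega
  lt l m hm := by unfold secondTail secondHead; split_ifs <;> omega
  covers l k hk hh := by
    refine ⟨if k % 2 = 0 ∨ k = 1 ∧ (l = 0 ∨ l % 2 = 1) then k / 2 else k / 2 + 1, ?_⟩
    unfold IsHole at hh
    unfold secondTail secondHead
    split_ifs <;> omega

lemma placement_third : Placement thirdTail thirdHead where
  le l m hm := by unfold thirdTail thirdHead; split_ifs <;> omega
  lt l m hm := by unfold thirdTail thirdHead; split_ifs <;> omega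
  covers l k hk hh := by
    refine ⟨k / 2, ?_⟩
    unfold IsHole at hh
    unfold thirdTail thirdHead
    split_ifs <;> omega

lemma placement_final : Placement thirdTail finalHead where
  le l m hm := by unfold thirdTail finalHead; omega
  lt l m hm := by unfold thirdTail finalHead; omega
  covers l k hk hh := by
    refine ⟨k / 2, ?_⟩
    unfold thirdTail finalHead
    omega

/-- The link `m` is contracted and the next one expanded. -/
def FollowsAt (a b : ℕ → ℕ → ℕ) (l m : ℕ) : Prop :=
  m ≤ l ∧ a l m = b l m ∧ a l (m + 1) ≠ b l (m + 1)

/-- One round of the tunneling primitive leads from the positions `a` and `b` to `a'` and `b'`. -/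
structure Tunnels (a b a' b' : ℕ → ℕ → ℕ) : Prop where
  near : ∀ l m, FollowsAt a b l m → a l (m + 1) ≤ a l m + 2
  follow : ∀ l m, FollowsAt a b l m → a' l m = a l m ∧ b' l m = a l (m + 1) ∧
    a' l (m + 1) = b l (m + 1) ∧ b' l (m + 1) = b l (m + 1)
  lead : ∀ l, a l (l + 1) = b l (l + 1) → a' l (l + 1) = a l (l + 1) ∧
    (a l (l + 1) = 2 * l + 2 ∧ b' l (l + 1) = 2 * l + 3 ∨
      a l (l + 1) < 2 * l + 2 ∧ b' l (l + 1) = 2 * l + 2)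
  rest : ∀ l m, m ≤ l + 1 → ¬ FollowsAt a b l m → (∀ m', m = m' + 1 → ¬ FollowsAt a b l m') →
    (m = l + 1 → a l m ≠ b l m) → a' l m = a l m ∧ b' l m = b l m

/-! ### Arithmetic of the three tunneling rounds -/

lemma start_cases (l m : ℕ) :
    m ≤ 1 ∧ startTail l m = m ∧ alternateHead l m = m ∨
    1 < m ∧ (l + m) % 2 = 0 ∧ startTail l m = 2 * m - 2 ∧ alternateHead l m = 2 * m - 2 ∨
    1 < m ∧ (l + m) % 2 = 1 ∧ startTail l m = 2 * m - 2 ∧ alternateHead l m = 2 * m - 1 := by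
  unfold startTail alternateHead
  split_ifs <;> omega

/-- The last alternative absorbs indices beyond the chain: for `l = 0` and odd `m > 1` the defining
formulas fit none of the others. -/
lemma first_cases (l m : ℕ) :
    m = 0 ∧ firstTail l m = 0 ∧ firstHead l m = 0 ∨
    m = 1 ∧ (l = 0 ∨ (l + m) % 2 = 0) ∧ firstTail l m = 1 ∧ firstHead l m = 2 ∨
    1 < m ∧ (l + m) % 2 = 0 ∧ firstTail l m = 2 * m - 2 ∧ firstHead l m = 2 * m ∨
    0 < m ∧ l ≠ 0 ∧ (l + m) % 2 = 1 ∧ firstTail l m = 2 * m - 1 ∧ firstHead l m = 2 * m - 1 ∨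
    l + 1 < m := by
  unfold firstTail firstHead
  split_ifs <;> omega

lemma second_cases (l m : ℕ) :
    m = 0 ∧ (l = 0 ∨ l % 2 = 1) ∧ secondTail l m = 0 ∧ secondHead l m = 1 ∨
    (l = 0 ∧ 0 < m ∨ l ≠ 0 ∧ (l + m) % 2 = 0) ∧
      secondTail l m = 2 * m ∧ secondHead l m = 2 * m ∨
    0 < m ∧ l ≠ 0 ∧ (l + m) % 2 = 1 ∧ secondTail l m = 2 * m - 1 ∧ secondHead l m = 2 * m := by
  unfold secondTail secondHead
  split_ifs <;> omega

lemma third_cases (l m : ℕ) : thirdTail l m = 2 * m ∧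
    (m ≠ 0 ∧ l ≠ 0 ∧ (l + m) % 2 = 1 ∧ thirdHead l m = 2 * m ∨
      (m = 0 ∨ l = 0 ∨ (l + m) % 2 = 0) ∧ thirdHead l m = 2 * m + 1) := by
  unfold thirdTail thirdHead
  split_ifs <;> omega

/-- The links `1 ≤ m ≤ l` with `l + m` even take over the bottom node `2 * m` of the next link. For
`l = 0` the first link expands to `2` instead. -/
lemma tunnels_first : Tunnels startTail alternateHead firstTail firstHead where
  near l m := by
    have h1 := start_cases l m
    have h2 := start_cases l (m + 1)
    rintro ⟨h3, h4, h5⟩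
    omega
  follow l m := by
    have h1 := start_cases l m
    have h2 := start_cases l (m + 1)
    have h3 := first_cases l m
    have h4 := first_cases l (m + 1)
    rintro ⟨h5, h6, h7⟩
    omega
  lead l := by
    have h1 := start_cases l (l + 1)
    have h2 := first_cases l (l + 1)
    intro h3
    omega
  rest l m := by
    intro h1 h2 h3 h4
    have h5 := start_cases l m
    have h6 := first_cases l m
    have h7 := start_cases l (m + 1)
    obtain rfl | ⟨m, rfl⟩ : m = 0 ∨ ∃ k, m = k + 1 := by cases m <;> simp
    · unfold FollowsAt at h2
      omega
    · have h8 := start_cases l m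
      have h3 := h3 m rfl
      unfold FollowsAt at h2 h3
      omega

/-- The other parity moves: for `l > 0`, links `1 ≤ m ≤ l` with `l + m` odd extend from `2 * m - 1`
to `2 * m`, and the first link expands to `2 * l + 2`. Link `0` takes over position `1` if `l` is
odd or zero. -/
lemma tunnels_second : Tunnels firstTail firstHead secondTail secondHead where
  near l m := by
    have h1 := first_cases l m
    have h2 := first_cases l (m + 1)
    rintro ⟨h3, h4, h5⟩
    omega
  follow l m := by
    have h1 := first_cases l m
    have h2 := first_cases l (m + 1)
    have h3 := second_cases l m
    have h4 := second_cases l (m + 1)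
    rintro ⟨h5, h6, h7⟩
    omega
  lead l := by
    have h1 := first_cases l (l + 1)
    have h2 := second_cases l (l + 1)
    intro h3
    omega
  rest l m := by
    intro h1 h2 h3 h4
    have h5 := first_cases l m
    have h6 := second_cases l m
    have h7 := first_cases l (m + 1)
    obtain rfl | ⟨m, rfl⟩ : m = 0 ∨ ∃ k, m = k + 1 := by cases m <;> simp
    · unfold FollowsAt at h2
      omega
    · have h8 := first_cases l m
      have h3 := h3 m rfl
      unfold FollowsAt at h2 h3
      omega

/-- For `l > 0`, links `m ≤ l` with `l + m` even extend from `2 * m` to `2 * m + 1`, which leaves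
the other parity, except for link `0`, contracted at bottom nodes. For `l = 0` the first link
expands to `3`. -/
lemma tunnels_third : Tunnels secondTail secondHead thirdTail thirdHead where
  near l m := by
    have h1 := second_cases l m
    have h2 := second_cases l (m + 1)
    rintro ⟨h3, h4, h5⟩
    omega
  follow l m := by
    have h1 := second_cases l m
    have h2 := second_cases l (m + 1)
    have h3 := third_cases l m
    have h4 := third_cases l (m + 1)
    rintro ⟨h5, h6, h7⟩
    omega
  lead l := by
    have h1 := second_cases l (l + 1)
    have h2 := third_cases l (l + 1)
    intro h3
    omega
  rest l m := by
    intro h1 h2 h3 h4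
    have h5 := second_cases l m
    have h6 := third_cases l m
    have h7 := second_cases l (m + 1)
    obtain rfl | ⟨m, rfl⟩ : m = 0 ∨ ∃ k, m = k + 1 := by cases m <;> simp
    · unfold FollowsAt at h2
      omega
    · have h8 := second_cases l m
      have h3 := h3 m rfl
      unfold FollowsAt at h2 h3
      omega

/-! ### Structures that differ only in the positions of the chains -/

/-- The chains `ch r`, for `r ∈ A`, of the structure `U` lie in disjoint pairs of rows. -/
structure ChainSystem (A : Set ℤ) (ch : ℤ → Chain ι) (U : Config ι) : Prop where
  succ_notMem : ∀ r ∈ A, r + 1 ∉ A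
  isChain : ∀ r ∈ A, IsChain U r (ch r)

/-- Amoebot `i` belongs to a chain. -/
def InChain (A : Set ℤ) (ch : ℤ → Chain ι) (i : ι) : Prop :=
  ∃ r ∈ A, ∃ m ≤ (ch r).len + 1, i = (ch r).link m

/-- The structure `S` arises from `U` by moving the links of the chains to the positions given by
`a` and `b`. -/
structure Layout (A : Set ℤ) (ch : ℤ → Chain ι) (U : Config ι) (a b : ℕ → ℕ → ℕ)
    (S : Config ι) : Prop where
  tail : ∀ r ∈ A, ∀ m ≤ (ch r).len + 1,
    S.tail ((ch r).link m) = pathNode r (ch r).col (a (ch r).len m)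
  head : ∀ r ∈ A, ∀ m ≤ (ch r).len + 1,
    S.head ((ch r).link m) = pathNode r (ch r).col (b (ch r).len m)
  other : ∀ i, ¬ InChain A ch i → S.tail i = U.tail i ∧ S.head i = U.head i

section System

variable {A : Set ℤ} {ch : ℤ → Chain ι} {U : Config ι}

/-- Paths of different chains are disjoint because two pairs of rows sharing a row would have
adjacent lower rows in `A`. -/
lemma ChainSystem.pathNode_inj (h : ChainSystem A ch U) {r r' : ℤ} (hr : r ∈ A) (hr' : r' ∈ A)
    {k k' : ℕ} (he : pathNode r (ch r).col k = pathNode r' (ch r').col k') : r = r' ∧ k = k' := by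
  obtain ⟨h1, h2⟩ := Prod.ext_iff.1 he
  simp only [pathNode] at h1 h2
  have h3 : r' ≠ r + 1 := fun e => h.succ_notMem r hr (e ▸ hr')
  have h4 : r ≠ r' + 1 := fun e => h.succ_notMem r' hr' (e ▸ hr)
  obtain rfl : r = r' := by omega
  exact ⟨rfl, by omega⟩

lemma ChainSystem.layout_start (h : ChainSystem A ch U) :
    Layout A ch U startTail startHead U := by
  refine ⟨fun r hr m hm => ?_, fun r hr m hm => ?_, fun _ _ => ⟨rfl, rfl⟩⟩ <;>
  · obtain ⟨h0, h1, -, h2, -⟩ := h.isChain r hr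
    obtain rfl | rfl | ⟨j, rfl⟩ : m = 0 ∨ m = 1 ∨ ∃ j, m = j + 2 := by
      rcases m with _ | _ | j <;> simp
    · simp [h0.1, h0.2, pathNode, startTail, startHead]
    · simp [h1.1, h1.2, pathNode, startTail, startHead]
    · simp only [h2 j (by omega), pathNode, startTail, startHead, Prod.ext_iff]
      split_ifs <;> omega

lemma ChainSystem.link_inj (h : ChainSystem A ch U) {r r' : ℤ} (hr : r ∈ A) (hr' : r' ∈ A)
    {m m' : ℕ} (hm : m ≤ (ch r).len + 1) (hm' : m' ≤ (ch r').len + 1)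
    (he : (ch r).link m = (ch r').link m') : r = r' ∧ m = m' := by
  have h1 := h.layout_start.tail r hr m hm
  rw [he, h.layout_start.tail r' hr' m' hm'] at h1
  obtain ⟨rfl, h2⟩ := h.pathNode_inj hr' hr h1
  refine ⟨rfl, ?_⟩
  unfold startTail at h2
  split_ifs at h2 <;> omega

/-- The nodes of the path of a chain are occupied only by the chain. -/
lemma ChainSystem.exists_link_of_mem (h : ChainSystem A ch U) {r : ℤ} (hr : r ∈ A) {k : ℕ}
    (hk : k ≤ 2 * (ch r).len + 3) {i : ι} (hi : pathNode r (ch r).col k ∈ U.nodes i) :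
    k ≤ 2 * (ch r).len + 1 ∧ ∃ m ≤ (ch r).len + 1, i = (ch r).link m := by
  have hk' : k ≤ 2 * (ch r).len + 1 := by
    by_contra hcon
    obtain ⟨-, -, -, -, h3, h4⟩ := h.isChain r hr
    obtain rfl | rfl : k = 2 * (ch r).len + 2 ∨ k = 2 * (ch r).len + 3 := by omega
    · refine h3 ⟨i, ?_⟩
      convert hi using 1
      simp only [pathNode, Prod.ext_iff]
      omega
    · refine h4 ⟨i, ?_⟩
      convert hi using 1
      simp only [pathNode, Prod.ext_iff]
      omega
  refine ⟨hk', if k ≤ 1 then k else k / 2 + 1, by split_ifs <;> omega, U.eq_of_mem_nodes hi ?_⟩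
  have hm : (if k ≤ 1 then k else k / 2 + 1) ≤ (ch r).len + 1 := by split_ifs <;> omega
  obtain hh | hh : k = startTail (ch r).len (if k ≤ 1 then k else k / 2 + 1) ∨
      k = startHead (ch r).len (if k ≤ 1 then k else k / 2 + 1) := by
    unfold startTail startHead
    split_ifs <;> omega
  · exact Or.inl (by rw [h.layout_start.tail r hr _ hm, ← hh])
  · exact Or.inr (by rw [h.layout_start.head r hr _ hm, ← hh]; rfl)

lemma ChainSystem.mem_occupied (h : ChainSystem A ch U) {r : ℤ} (hr : r ∈ A) {k : ℕ}
    (hk : k ≤ 2 * (ch r).len + 1) : pathNode r (ch r).col k ∈ U.occupied := by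
  have hm : (if k ≤ 1 then k else k / 2 + 1) ≤ (ch r).len + 1 := by split_ifs <;> omega
  refine ⟨(ch r).link (if k ≤ 1 then k else k / 2 + 1), ?_⟩
  obtain hh | hh : k = startTail (ch r).len (if k ≤ 1 then k else k / 2 + 1) ∨
      k = startHead (ch r).len (if k ≤ 1 then k else k / 2 + 1) := by
    unfold startTail startHead
    split_ifs <;> omega
  · exact Or.inl (by rw [h.layout_start.tail r hr _ hm, ← hh])
  · exact Or.inr (by rw [h.layout_start.head r hr _ hm, ← hh]; rfl)

/-- No collisions arise: links of one chain occupy disjoint intervals of the path in increasing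
order, different chains have disjoint paths, and nothing outside the chains is on a path. -/
lemma ChainSystem.exists_layout (h : ChainSystem A ch U) {a b : ℕ → ℕ → ℕ} (hp : Placement a b) :
    ∃ S, Layout A ch U a b S := by
  have hex : ∀ i, ∃ u v : Node, (∀ r ∈ A, ∀ m ≤ (ch r).len + 1, i = (ch r).link m →
      u = pathNode r (ch r).col (a (ch r).len m) ∧ v = pathNode r (ch r).col (b (ch r).len m)) ∧
      (¬ InChain A ch i → u = U.tail i ∧ v = U.head i) := by
    intro i
    by_cases hi : InChain A ch i
    · obtain ⟨r, hr, m, hm, rfl⟩ := hi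
      refine ⟨pathNode r (ch r).col (a (ch r).len m), pathNode r (ch r).col (b (ch r).len m),
        fun r' hr' m' hm' he => ?_, fun hn => absurd ⟨r, hr, m, hm, rfl⟩ hn⟩
      obtain ⟨rfl, rfl⟩ := h.link_inj hr hr' hm hm' he
      exact ⟨rfl, rfl⟩
    · exact ⟨U.tail i, U.head i, fun r hr m hm he => absurd ⟨r, hr, m, hm, he⟩ hi,
        fun _ => ⟨rfl, rfl⟩⟩
  choose f g hfg hfg' using hex
  have hsep : ∀ i j, InChain A ch i → ¬ InChain A ch j → ∀ w : Node,
      (w = f i ∨ w = g i) → (w = f j ∨ w = g j) → False := by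
    rintro i j ⟨r, hr, m, hm, rfl⟩ hj w hi hj'
    obtain ⟨e1, e2⟩ := hfg' j hj
    obtain ⟨e3, e4⟩ := hfg _ r hr m hm rfl
    rw [e1, e2] at hj'
    rw [e3, e4] at hi
    obtain ⟨p1, -, p3⟩ := hp.le _ _ hm
    obtain ⟨k, hk, rfl⟩ : ∃ k ≤ 2 * (ch r).len + 3, w = pathNode r (ch r).col k := by
      obtain e | e := hi
      · exact ⟨_, p1.trans p3, e⟩
      · exact ⟨_, p3, e⟩
    obtain ⟨-, m', hm', e⟩ := h.exists_link_of_mem hr hk hj'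
    exact hj ⟨r, hr, m', hm', e⟩
  refine ⟨⟨f, g, fun i => ?_, fun i j hij => Set.disjoint_left.2 fun w hi hj => ?_⟩,
    fun r hr m hm => (hfg _ r hr m hm rfl).1, fun r hr m hm => (hfg _ r hr m hm rfl).2, hfg'⟩
  · by_cases hi : InChain A ch i
    · obtain ⟨r, hr, m, hm, hl⟩ := hi
      rw [(hfg i r hr m hm hl).1, (hfg i r hr m hm hl).2]
      obtain ⟨p1, p2, -⟩ := hp.le _ _ hm
      obtain e | e := p1.eq_or_lt
      · rw [e]; exact Or.inl rfl
      · exact Or.inr (pathNode_adj e p2)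
    · rw [(hfg' i hi).1, (hfg' i hi).2]
      exact U.edge i
  · by_cases hi' : InChain A ch i <;> by_cases hj' : InChain A ch j
    · obtain ⟨r, hr, m, hm, rfl⟩ := hi'
      obtain ⟨r', hr', m', hm', rfl⟩ := hj'
      obtain ⟨e1, e2⟩ := hfg _ r hr m hm rfl
      obtain ⟨e1', e2'⟩ := hfg _ r' hr' m' hm' rfl
      have p := hp.le _ _ hm
      have p' := hp.le _ _ hm'
      have q : r = r' ∧ (a (ch r).len m = a (ch r').len m' ∨ a (ch r).len m = b (ch r').len m' ∨
          b (ch r).len m = a (ch r').len m' ∨ b (ch r).len m = b (ch r').len m') := by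
        obtain e | e := hi <;> obtain e' | e' := hj <;>
          simp only [e1, e2, e1', e2'] at e e' <;>
          have := h.pathNode_inj hr hr' (e.symm.trans e') <;> tauto
      obtain ⟨rfl, q⟩ := q
      have hmm : m ≠ m' := fun e => hij (by rw [e])
      obtain hlt | hlt := lt_or_gt_of_ne hmm
      · have := hp.lt_of_lt hlt hm'
        omega
      · have := hp.lt_of_lt hlt hm
        omega
    · exact hsep i j hi' hj' w hi hj
    · exact hsep j i hj' hi' w hj hi
    · simp only [hfg' i hi', hfg' j hj'] at hi hj
      exact hij (U.eq_of_mem_nodes (v := w) hi hj)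

lemma Layout.contracted_iff {a b : ℕ → ℕ → ℕ} {S : Config ι} (hS : Layout A ch U a b S) {r : ℤ}
    (hr : r ∈ A) {m : ℕ} (hm : m ≤ (ch r).len + 1) :
    S.Contracted ((ch r).link m) ↔ a (ch r).len m = b (ch r).len m := by
  rw [Config.Contracted, hS.tail r hr m hm, hS.head r hr m hm]
  simp only [pathNode, Prod.ext_iff]
  omega

/-- The occupied set contains that of `U` minus the holes, which is connected by
`GridConnected.diff`; every further node is a hole or in the new column, adjacent to this set. -/
lemma ChainSystem.gridConnected (h : ChainSystem A ch U) {a b : ℕ → ℕ → ℕ} (hp : Placement a b)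
    {S : Config ι} (hS : Layout A ch U a b S) (hU : GridConnected U.occupied) :
    GridConnected S.occupied := by
  let T : Set Node := {v | ∃ r ∈ A, ∃ k ≤ 2 * (ch r).len + 1, IsHole (ch r).len k ∧
    v = pathNode r (ch r).col k}
  have hmemT : ∀ r ∈ A, ∀ k, pathNode r (ch r).col k ∈ T →
      k ≤ 2 * (ch r).len + 1 ∧ IsHole (ch r).len k := by
    rintro r hr k ⟨r', hr', k', hk', hh, he⟩
    obtain ⟨rfl, rfl⟩ := h.pathNode_inj hr hr' he
    exact ⟨hk', hh⟩
  have hO : GridConnected (U.occupied \ T) := by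
    refine hU.diff ?_
    rintro x y ⟨r, hr, k, hk, hh, he⟩
    obtain ⟨e1, e2⟩ := Prod.ext_iff.1 he
    simp only [pathNode] at e1 e2
    have hh' := hh
    unfold IsHole at hh'
    have key : ∀ k' ≤ 2 * (ch r).len + 1, ¬ IsHole (ch r).len k' → ∀ v : Node,
        v = pathNode r (ch r).col k' → v ∈ U.occupied \ T := by
      rintro k' hk' hh' _ rfl
      exact ⟨h.mem_occupied hr hk', fun hT => hh' (hmemT r hr k' hT).2⟩
    -- Holes are top nodes of pairs of rows, so holes in rows `y` and `y + 1` would make two pairs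
    -- overlap.
    have above : ∀ z : ℤ, (z, y + 1) ∉ T := by
      rintro z ⟨r', hr', k', hk', hh'', he'⟩
      obtain ⟨-, e3⟩ := Prod.ext_iff.1 he'
      simp only [pathNode] at e3
      unfold IsHole at hh''
      refine h.succ_notMem r hr ?_
      rwa [show r + 1 = r' by omega]
    -- The neighbours below and below right have even position; the neighbouring top nodes have the
    -- other column parity. Column `l` has no hole, so `k + 2` is still on the original path.
    refine ⟨key (k - 1) ?_ ?_ _ ?_, key (k + 2) ?_ ?_ _ ?_, key (k + 1) ?_ ?_ _ ?_,
      key (k - 2) ?_ ?_ _ ?_, above x, above (x - 1)⟩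
    all_goals first
      | omega
      | (unfold IsHole; omega)
      | (simp only [pathNode, Prod.ext_iff]; omega)
  refine hO.of_subset ?_ ?_
  · rintro v ⟨⟨i, hi⟩, hT⟩
    by_cases hc : InChain A ch i
    · obtain ⟨r, hr, m, hm, rfl⟩ := hc
      obtain ⟨k, hk, rfl⟩ : ∃ k ≤ 2 * (ch r).len + 1, v = pathNode r (ch r).col k := by
        obtain e | e := hi
        · refine ⟨_, ?_, e.trans (h.layout_start.tail r hr m hm)⟩
          unfold startTail; split_ifs <;> omega
        · refine ⟨_, ?_, (show v = _ from e).trans (h.layout_start.head r hr m hm)⟩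
          unfold startHead; split_ifs <;> omega
      obtain ⟨m', hm', e | e⟩ := hp.covers _ k hk fun hh => hT ⟨r, hr, k, hk, hh, rfl⟩
      · exact ⟨(ch r).link m', Or.inl (by rw [hS.tail r hr m' hm', e])⟩
      · exact ⟨(ch r).link m', Or.inr (by rw [hS.head r hr m' hm', e]; rfl)⟩
    · refine ⟨i, ?_⟩
      rwa [Config.nodes, (hS.other i hc).1, (hS.other i hc).2]
  · rintro v ⟨i, hi⟩
    by_cases hc : InChain A ch i
    · obtain ⟨r, hr, m, hm, rfl⟩ := hc
      obtain ⟨p1, -, p3⟩ := hp.le _ _ hm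
      obtain ⟨k, hk, rfl⟩ : ∃ k ≤ 2 * (ch r).len + 3, v = pathNode r (ch r).col k := by
        obtain e | e := hi
        · exact ⟨_, p1.trans p3, e.trans (hS.tail r hr m hm)⟩
        · exact ⟨_, p3, (show v = _ from e).trans (hS.head r hr m hm)⟩
      have key : ∀ k' ≤ 2 * (ch r).len + 1, ¬ IsHole (ch r).len k' →
          pathNode r (ch r).col k' ∈ U.occupied \ T :=
        fun k' hk' hh => ⟨h.mem_occupied hr hk', fun hT => hh (hmemT r hr k' hT).2⟩
      by_cases hk1 : k ≤ 2 * (ch r).len + 1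
      · by_cases hh : IsHole (ch r).len k
        · unfold IsHole at hh
          refine Or.inr ⟨_, key (k - 1) (by omega) (by unfold IsHole; omega), ?_⟩
          exact (pathNode_adj (by omega) (by omega)).symm
        · exact Or.inl (key k hk1 hh)
      -- A node of the new column hangs on its left neighbour in column `l`.
      · refine Or.inr ⟨_, key (k - 2) (by omega) (by unfold IsHole; omega), ?_⟩
        exact (pathNode_adj (by omega) (by omega)).symm
    · rw [Config.nodes, (hS.other i hc).1, (hS.other i hc).2] at hi
      refine Or.inl ⟨⟨i, hi⟩, ?_⟩
      rintro ⟨r, hr, k, hk, -, rfl⟩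
      obtain ⟨-, m, hm, e⟩ := h.exists_link_of_mem hr (by omega) hi
      exact hc ⟨r, hr, m, hm, e⟩

/-! ### The rounds of a tunneling step -/

lemma ChainSystem.alternateRound (h : ChainSystem A ch U) (hU : GridConnected U.occupied)
    {S : Config ι} (hS : Layout A ch U startTail alternateHead S) : AlternateRound A ch U S := by
  classical
  have hL := h.layout_start
  have hcon := h.gridConnected placement_alternate hS hU
  have halt : ∀ i, IsAlternate A ch i → ∃ r ∈ A, ∃ m ≤ (ch r).len + 1, i = (ch r).link m ∧
      2 ≤ m ∧ ((ch r).len + m) % 2 = 0 := by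
    rintro i ⟨r, hr, j, hj, ho, rfl⟩
    -- Counting from the right with the rightmost excluded means `l + m` even, where `m = j + 2`.
    rw [Nat.odd_iff] at ho
    exact ⟨r, hr, j + 2, by omega, rfl, by omega, by omega⟩
  have hyes : ∀ i, IsAlternate A ch i → S.tail i = U.tail i ∧ S.head i = U.tail i := by
    intro i hi
    obtain ⟨r, hr, m, hm, rfl, h2, h3⟩ := halt i hi
    rw [hS.tail r hr m hm, hS.head r hr m hm, hL.tail r hr m hm, alternateHead,
      if_neg (by omega), if_pos h3, startTail, if_neg (by omega)]
    exact ⟨rfl, rfl⟩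
  have hno : ∀ i, ¬ IsAlternate A ch i → S.tail i = U.tail i ∧ S.head i = U.head i := by
    intro i hi
    by_cases hc : InChain A ch i
    · obtain ⟨r, hr, m, hm, rfl⟩ := hc
      rw [hS.tail r hr m hm, hS.head r hr m hm, hL.tail r hr m hm, hL.head r hr m hm]
      refine ⟨rfl, congrArg _ ?_⟩
      have : ¬ (2 ≤ m ∧ ((ch r).len + m) % 2 = 0) := by
        rintro ⟨h2, h3⟩
        refine hi ⟨r, hr, m - 2, by omega, ?_, by rw [show m - 2 + 2 = m by omega]⟩
        rw [Nat.odd_iff]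
        omega
      unfold alternateHead startHead
      split_ifs <;> omega
    · exact hS.other i hc
  let act : ι → Action ι := fun i => if IsAlternate A ch i then .contract else .idle
  refine ⟨act, roundBy_of_shrink hcon (fun i hi => ?_) (fun i hi => ?_) (fun i => ?_),
    fun i => ⟨fun hi => ⟨if_pos hi, hyes i hi⟩, fun hi => ⟨if_neg hi, hno i hi⟩⟩⟩
  · by_cases ha : IsAlternate A ch i
    · simp [act, ha] at hi
    · exact hno i ha
  · by_cases ha : IsAlternate A ch i
    · refine ⟨?_, hyes i ha⟩
      obtain ⟨r, hr, m, hm, rfl, h2, h3⟩ := halt i ha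
      rw [hL.contracted_iff hr hm]
      unfold startTail startHead
      split_ifs <;> omega
    · simp [act, ha] at hi
  · by_cases ha : IsAlternate A ch i
    · exact Or.inr (if_pos ha)
    · exact Or.inl (if_neg ha)

/-- `Tunnels` supplies the positions. What remains is that the roles of follower, predecessor and
leader exclude each other and that handover partners are unique, so that a consistent action can be
assigned. -/
lemma ChainSystem.tunnelRound (h : ChainSystem A ch U) (hU : GridConnected U.occupied)
    {a b a' b' : ℕ → ℕ → ℕ} (hp : Placement a b) (ht : Tunnels a b a' b') {S S' : Config ι}
    (hS : Layout A ch U a b S) (hS' : Layout A ch U a' b' S') : TunnelRound A ch S S' := by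
  classical
  have hcon := h.gridConnected hp hS hU
  have hfol : ∀ i p, Follows A ch S i p → ∃ r ∈ A, ∃ m, FollowsAt a b (ch r).len m ∧
      i = (ch r).link m ∧ p = (ch r).link (m + 1) := by
    rintro i p ⟨r, hr, m, hm, rfl, rfl, h1, h2⟩
    rw [hS.contracted_iff hr (by omega)] at h1 h2
    exact ⟨r, hr, m, ⟨hm, h1, h2⟩, rfl, rfl⟩
  have hfol' : ∀ r ∈ A, ∀ m, FollowsAt a b (ch r).len m →
      Follows A ch S ((ch r).link m) ((ch r).link (m + 1)) := by
    rintro r hr m ⟨hm, h1, h2⟩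
    refine ⟨r, hr, m, hm, rfl, rfl, ?_, ?_⟩
    · rwa [hS.contracted_iff hr (by omega)]
    · rwa [hS.contracted_iff hr (by omega)]
  have hpos : ∀ i p, Follows A ch S i p → S'.tail i = S.tail i ∧ S'.head i = S.tail p ∧
      S'.tail p = S.head p ∧ S'.head p = S.head p ∧ grid.Adj (S.tail i) (S.tail p) := by
    intro i p hip
    obtain ⟨r, hr, m, hm, rfl, rfl⟩ := hfol i p hip
    have hm1 : m ≤ (ch r).len + 1 := by have := hm.1; omega
    have hm2 : m + 1 ≤ (ch r).len + 1 := by have := hm.1; omega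
    rw [hS'.tail r hr _ hm1, hS'.head r hr _ hm1, hS'.tail r hr _ hm2, hS'.head r hr _ hm2,
      hS.tail r hr _ hm1, hS.tail r hr _ hm2, hS.head r hr _ hm2]
    obtain ⟨e1, e2, e3, e4⟩ := ht.follow _ _ hm
    rw [e1, e2, e3, e4]
    refine ⟨rfl, rfl, rfl, rfl, pathNode_adj ?_ (ht.near _ _ hm)⟩
    have h1 := hp.lt _ _ hm.1
    have h2 := hm.2.1
    omega
  have hlead : ∀ i v, Leads A ch S i v → S'.tail i = S.tail i ∧ S'.head i = v ∧
      S.Contracted i ∧ ¬ S'.Contracted i := by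
    rintro i v ⟨r, hr, rfl, hc, hv⟩
    have hc' := hc
    rw [hS.contracted_iff hr le_rfl] at hc'
    rw [hS'.contracted_iff hr le_rfl, hS'.tail r hr _ le_rfl, hS'.head r hr _ le_rfl,
      hS.tail r hr _ le_rfl]
    rw [hS.head r hr _ le_rfl, ← hc'] at hv
    obtain ⟨e1, e2⟩ := ht.lead _ hc'
    refine ⟨by rw [e1], ?_, hc, by omega⟩
    simp only [pathNode, ne_eq, Prod.ext_iff] at hv ⊢
    obtain ⟨e2, e3⟩ | ⟨e2, e3⟩ := e2 <;> rw [e3] <;> omega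
  have hrest : ∀ i, (∀ p, ¬ Follows A ch S i p) → (∀ p, ¬ Follows A ch S p i) →
      (∀ v, ¬ Leads A ch S i v) → S'.tail i = S.tail i ∧ S'.head i = S.head i := by
    intro i h1 h2 h3
    by_cases hc : InChain A ch i
    · obtain ⟨r, hr, m, hm, rfl⟩ := hc
      rw [hS'.tail r hr _ hm, hS'.head r hr _ hm, hS.tail r hr _ hm, hS.head r hr _ hm]
      obtain ⟨e1, e2⟩ := ht.rest _ m hm (fun hf => h1 _ (hfol' r hr m hf))
        (by rintro m' rfl hf; exact h2 _ (hfol' r hr m' hf)) (by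
          rintro rfl he
          have hcc := (hS.contracted_iff hr le_rfl).2 he
          by_cases hh : S.head ((ch r).link ((ch r).len + 1)) = ((ch r).col + (ch r).len + 1, r)
          · exact h3 _ ⟨r, hr, rfl, hcc, Or.inr ⟨hh, rfl⟩⟩
          · exact h3 _ ⟨r, hr, rfl, hcc, Or.inl ⟨hh, rfl⟩⟩)
      rw [e1, e2]
      exact ⟨rfl, rfl⟩
    · rw [(hS'.other i hc).1, (hS'.other i hc).2, (hS.other i hc).1, (hS.other i hc).2]
      exact ⟨rfl, rfl⟩
  have hcf : ∀ i p, Follows A ch S i p → S.Contracted i ∧ ¬ S.Contracted p := by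
    rintro i p ⟨_, _, _, _, _, _, h1, h2⟩
    exact ⟨h1, h2⟩
  have huniq : ∀ i p q, Follows A ch S i p → Follows A ch S i q → p = q := by
    rintro i p q ⟨r, hr, m, hm, rfl, rfl, -⟩ ⟨r', hr', m', hm', he, rfl, -⟩
    obtain ⟨rfl, rfl⟩ := h.link_inj hr hr' (by omega) (by omega) he
    rfl
  have huniq' : ∀ i p q, Follows A ch S p i → Follows A ch S q i → p = q := by
    rintro i p q ⟨r, hr, m, hm, rfl, rfl, -⟩ ⟨r', hr', m', hm', rfl, he, -⟩
    obtain ⟨rfl, hmm⟩ := h.link_inj hr hr' (by omega) (by omega) he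
    rw [Nat.add_right_cancel hmm]
  have hlf : ∀ i v p, Leads A ch S i v → ¬ Follows A ch S i p := by
    rintro i v p ⟨r, hr, rfl, -⟩ ⟨r', hr', m', hm', he, -⟩
    obtain ⟨rfl, he⟩ := h.link_inj hr hr' (by omega) (by omega) he
    omega
  have hlf' : ∀ i v p, Leads A ch S i v → ¬ Follows A ch S p i := fun i v p hl hf =>
    (hcf p i hf).2 (hlead i v hl).2.2.1
  let act : ι → Action ι := fun i =>
    if h1 : ∃ p, Follows A ch S i p then .handover h1.choose
    else if h2 : ∃ p, Follows A ch S p i then .handover h2.choose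
    else if ∃ v, Leads A ch S i v then .expand else .idle
  have act1 : ∀ i p, Follows A ch S i p → act i = .handover p := by
    intro i p hip
    have h1 : ∃ p, Follows A ch S i p := ⟨p, hip⟩
    simp only [act, dif_pos h1, huniq i _ _ h1.choose_spec hip]
  have act2 : ∀ i p, Follows A ch S i p → act p = .handover i := by
    intro i p hip
    have h1 : ¬ ∃ q, Follows A ch S p q := fun ⟨q, hq⟩ => (hcf i p hip).2 (hcf p q hq).1
    have h2 : ∃ q, Follows A ch S q p := ⟨i, hip⟩
    simp only [act, dif_neg h1, dif_pos h2, huniq' p _ _ h2.choose_spec hip]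
  have act3 : ∀ i v, Leads A ch S i v → act i = .expand := by
    intro i v hl
    have h1 : ¬ ∃ q, Follows A ch S i q := fun ⟨q, hq⟩ => hlf i v q hl hq
    have h2 : ¬ ∃ q, Follows A ch S q i := fun ⟨q, hq⟩ => hlf' i v q hl hq
    have h3 : ∃ v, Leads A ch S i v := ⟨v, hl⟩
    simp only [act, dif_neg h1, dif_neg h2, if_pos h3]
  have act4 : ∀ i, (∀ p, ¬ Follows A ch S i p) → (∀ p, ¬ Follows A ch S p i) →
      (∀ v, ¬ Leads A ch S i v) → act i = .idle := by
    intro i h1 h2 h3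
    simp [act, h1, h2, h3]
  have hcases : ∀ i, (∃ p, Follows A ch S i p) ∨ (∃ p, Follows A ch S p i) ∨
      (∃ v, Leads A ch S i v) ∨ ((∀ p, ¬ Follows A ch S i p) ∧ (∀ p, ¬ Follows A ch S p i) ∧
      (∀ v, ¬ Leads A ch S i v)) := by
    intro i
    simp only [← not_exists]
    tauto
  have hstat : ∀ i p, Follows A ch S i p → StaticHandover S S' i p := by
    intro i p hip
    obtain ⟨e1, e2, e3, e4, e5⟩ := hpos i p hip
    refine ⟨(hcf i p hip).1, (hcf i p hip).2, e5, ?_, ?_⟩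
    · rw [Config.nodes, e1, e2]
    · rw [Config.nodes, e3, e4, Set.pair_eq_singleton]
  refine ⟨act, roundBy_of_static hcon (fun i hi => ?_) (fun i hi => ?_) (fun i hi => ?_)
    (fun i j hij => ?_), fun i p hip => ?_, fun i v hl => ?_, fun i h1 h2 h3 => ?_⟩
  · obtain ⟨p, hp⟩ | ⟨p, hp⟩ | ⟨v, hv⟩ | ⟨h1, h2, h3⟩ := hcases i
    · simp [act1 i p hp] at hi
    · simp [act2 p i hp] at hi
    · simp [act3 i v hv] at hi
    · exact hrest i h1 h2 h3
  · obtain ⟨p, hp⟩ | ⟨p, hp⟩ | ⟨v, hv⟩ | ⟨h1, h2, h3⟩ := hcases i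
    · simp [act1 i p hp] at hi
    · simp [act2 p i hp] at hi
    · obtain ⟨e1, -, e3, e4⟩ := hlead i v hv
      exact ⟨e3, e4, Or.inl e1.symm⟩
    · simp [act4 i h1 h2 h3] at hi
  · obtain ⟨p, hp⟩ | ⟨p, hp⟩ | ⟨v, hv⟩ | ⟨h1, h2, h3⟩ := hcases i
    · simp [act1 i p hp] at hi
    · simp [act2 p i hp] at hi
    · simp [act3 i v hv] at hi
    · simp [act4 i h1 h2 h3] at hi
  · obtain ⟨p, hp⟩ | ⟨p, hp⟩ | ⟨v, hv⟩ | ⟨h1, h2, h3⟩ := hcases i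
    · rw [act1 i p hp, Action.handover.injEq] at hij
      subst hij
      exact ⟨act2 i p hp, Or.inl (hstat i p hp)⟩
    · rw [act2 p i hp, Action.handover.injEq] at hij
      subst hij
      exact ⟨act1 p i hp, Or.inr (hstat p i hp)⟩
    · simp [act3 i v hv] at hij
    · simp [act4 i h1 h2 h3] at hij
  · obtain ⟨e1, e2, e3, e4, -⟩ := hpos i p hip
    exact ⟨⟨act1 i p hip, e1, e2⟩, act2 i p hip, e3, e4⟩
  · exact ⟨act3 i v hl, (hlead i v hl).1, (hlead i v hl).2.1⟩
  · exact ⟨act4 i h1 h2 h3, hrest i h1 h2 h3⟩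

lemma ChainSystem.reexpandRound (h : ChainSystem A ch U) (hU : GridConnected U.occupied)
    {S S' : Config ι} (hS : Layout A ch U thirdTail thirdHead S)
    (hS' : Layout A ch U thirdTail finalHead S') : ReexpandRound A ch S S' := by
  classical
  have hcon := h.gridConnected placement_third hS hU
  have hyes : ∀ i, IsContractedInChain A ch S i →
      S'.tail i = S.tail i ∧ S'.head i = S.tail i + (0, 1) := by
    rintro i ⟨-, r, hr, m, hm, rfl⟩
    rw [hS'.tail r hr m hm, hS'.head r hr m hm, hS.tail r hr m hm]
    refine ⟨rfl, ?_⟩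
    simp only [pathNode, thirdTail, finalHead, Prod.ext_iff, Prod.mk_add_mk]
    omega
  have hno : ∀ i, ¬ IsContractedInChain A ch S i →
      S'.tail i = S.tail i ∧ S'.head i = S.head i := by
    intro i hi
    by_cases hc : InChain A ch i
    · obtain ⟨r, hr, m, hm, rfl⟩ := hc
      have hn : ¬ S.Contracted ((ch r).link m) := fun hn => hi ⟨hn, r, hr, m, hm, rfl⟩
      rw [hS.contracted_iff hr hm] at hn
      rw [hS'.tail r hr m hm, hS'.head r hr m hm, hS.tail r hr m hm, hS.head r hr m hm]
      refine ⟨rfl, congrArg _ ?_⟩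
      revert hn
      unfold thirdTail thirdHead finalHead
      split_ifs <;> omega
    · rw [(hS'.other i hc).1, (hS'.other i hc).2, (hS.other i hc).1, (hS.other i hc).2]
      exact ⟨rfl, rfl⟩
  let act : ι → Action ι := fun i => if IsContractedInChain A ch S i then .expand else .idle
  refine ⟨act, roundBy_of_static hcon (fun i hi => ?_) (fun i hi => ?_) (fun i hi => ?_)
    (fun i j hi => ?_),
    fun i => ⟨fun hi => ⟨if_pos hi, hyes i hi⟩, fun hi => ⟨if_neg hi, hno i hi⟩⟩⟩
  all_goals by_cases ha : IsContractedInChain A ch S i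
  · simp [act, ha] at hi
  · exact hno i ha
  · obtain ⟨e1, e2⟩ := hyes i ha
    refine ⟨ha.1, ?_, Or.inl e1.symm⟩
    rw [Config.Contracted, e1, e2]
    simp [Prod.ext_iff]
  all_goals simp [act, ha] at hi

/-- The chains can be moved by the rounds of a tunneling step. -/
lemma ChainSystem.exists_final (h : ChainSystem A ch U) (hU : GridConnected U.occupied) :
    ∃ S₁ S₂ S₃ S₄ S' : Config ι, AlternateRound A ch U S₁ ∧ TunnelRound A ch S₁ S₂ ∧
      TunnelRound A ch S₂ S₃ ∧ TunnelRound A ch S₃ S₄ ∧ ReexpandRound A ch S₄ S' ∧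
      Layout A ch U thirdTail finalHead S' := by
  obtain ⟨S₁, h₁⟩ := h.exists_layout placement_alternate
  obtain ⟨S₂, h₂⟩ := h.exists_layout placement_first
  obtain ⟨S₃, h₃⟩ := h.exists_layout placement_second
  obtain ⟨S₄, h₄⟩ := h.exists_layout placement_third
  obtain ⟨S', h'⟩ := h.exists_layout placement_final
  exact ⟨S₁, S₂, S₃, S₄, S', h.alternateRound hU h₁,
    h.tunnelRound hU placement_alternate tunnels_first h₁ h₂,
    h.tunnelRound hU placement_first tunnels_second h₂ h₃,
    h.tunnelRound hU placement_second tunnels_third h₃ h₄, h.reexpandRound hU h₄ h', h'⟩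

end System

/-! ### The new positions of rows -/

/-- The new position of row `y` when the rows `r` and `r + 1` are merged for every `r ∈ P`. -/
def rowShift (P : Finset ℤ) (y : ℤ) : ℤ := y - (P.filter (· < y)).card

/-- Passing row `y` costs one more merge exactly if `y` is the lower row of a pair. -/
lemma rowShift_succ (P : Finset ℤ) (y : ℤ) :
    rowShift P (y + 1) = rowShift P y + if y ∈ P then 0 else 1 := by
  have hfilter : P.filter (· < y + 1) = P.filter (· < y) ∪ if y ∈ P then {y} else ∅ := by
    ext z
    split_ifs with hy
    · simp only [mem_filter, mem_union, mem_singleton]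
      constructor
      · rintro ⟨h1, h2⟩
        by_cases hz : z = y
        · exact Or.inr hz
        · exact Or.inl ⟨h1, by omega⟩
      · rintro (⟨h1, h2⟩ | rfl)
        · exact ⟨h1, by omega⟩
        · exact ⟨hy, by omega⟩
    · simp only [mem_filter, union_empty, and_congr_right_iff]
      intro hz
      have : z ≠ y := fun e => hy (e ▸ hz)
      omega
  have hcard : (P.filter (· < y + 1)).card = (P.filter (· < y)).card + if y ∈ P then 1 else 0 := by
    rw [hfilter, card_union_of_disjoint]
    · split_ifs <;> simp
    · split_ifs <;> simp
  unfold rowShift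
  rw [hcard]
  split_ifs <;> push_cast <;> ring

lemma rowShift_monotone (P : Finset ℤ) : Monotone (rowShift P) :=
  monotone_int_of_le_succ fun y => by
    rw [rowShift_succ]
    split_ifs <;> omega

lemma rowShift_succ_of_mem {P : Finset ℤ} {r : ℤ} (hr : r ∈ P) :
    rowShift P (r + 1) = rowShift P r := by
  rw [rowShift_succ, if_pos hr, add_zero]

/-- The shift is monotone and stalls only after rows of `P`, no two of which are consecutive, so its
plateaus have length at most two. -/
lemma eq_of_rowShift_eq {P : Finset ℤ} (hP : ∀ r ∈ P, r + 1 ∉ P) {y y' : ℤ} (hlt : y < y')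
    (h : rowShift P y = rowShift P y') : y' = y + 1 ∧ y ∈ P := by
  have h1 : y ∈ P := by
    by_contra hy
    have h2 := rowShift_succ P y
    rw [if_neg hy] at h2
    have := rowShift_monotone P (show y + 1 ≤ y' by omega)
    omega
  refine ⟨?_, h1⟩
  by_contra hne
  have h2 := rowShift_succ P (y + 1)
  rw [if_neg (hP y h1), rowShift_succ_of_mem h1] at h2
  have := rowShift_monotone P (show y + 1 + 1 ≤ y' by omega)
  omega

/-! ### The structures between the phases of an iteration -/

/-- In every pair of rows, each column is unoccupied or occupied by an expanded amoebot or by two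
contracted ones, and all other amoebots are contracted. -/
structure Aligned (P : Finset ℤ) (U : Config ι) : Prop where
  vertical : ∀ i, ¬ U.Contracted i → (U.tail i).2 ∈ P ∧ U.head i = U.tail i + (0, 1)
  above : ∀ i, U.Contracted i → (U.tail i).2 ∈ P → ∃ j, U.ContractedAt j (U.tail i + (0, 1))
  below : ∀ i, U.Contracted i → (U.tail i).2 - 1 ∈ P → ∃ j, U.ContractedAt j (U.tail i - (0, 1))
  connected : GridConnected U.occupied

/-- An amoebot that cannot expand has a partner in its column that cannot either. The last two
conclusions are for counting: the merged row is invariant, and amoebots still contracted have not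
moved. -/
lemma exists_expandPhase {P : Finset ℤ} (hP : ∀ r ∈ P, r + 1 ∉ P) {S : Config ι}
    (hS : S ∈ Arbitrary ι) : ∃ U, ExpandPhase P S U ∧ Aligned P U ∧
      (∀ i, rowShift P (U.tail i).2 = rowShift P (S.tail i).2) ∧
      ∀ i, U.Contracted i → U.tail i = S.tail i := by
  classical
  obtain ⟨hc, hconn⟩ := hS
  rw [S.connectedBy_bondGraph_iff] at hconn
  let f : ι → Node := fun i => if FreeBelow P S i then S.tail i - (0, 1) else S.tail i
  let g : ι → Node := fun i => if FreeAbove P S i then S.tail i + (0, 1) else S.tail i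
  have hnodes : ∀ i (w : Node), w = f i ∨ w = g i → w = S.tail i ∨
      (FreeAbove P S i ∧ w = S.tail i + (0, 1)) ∨ (FreeBelow P S i ∧ w = S.tail i - (0, 1)) := by
    rintro i w (rfl | rfl)
    · by_cases h : FreeBelow P S i <;> simp [f, h]
    · by_cases h : FreeAbove P S i <;> simp [g, h]
  have hexcl : ∀ i, FreeAbove P S i → ¬ FreeBelow P S i := by
    rintro i ⟨h1, -⟩ ⟨h2, -⟩
    have := hP _ h2
    rw [sub_add_cancel] at this
    exact this h1
  have hocc : ∀ i, S.tail i ∈ S.occupied := fun i => ⟨i, S.tail_mem i⟩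
  have hinj : ∀ i j, S.tail i = S.tail j → i = j := fun i j e =>
    S.eq_of_mem_nodes (S.tail_mem i) (e ▸ S.tail_mem j)
  let U : Config ι := ⟨f, g, fun i => ?_, fun i j hij => Set.disjoint_left.2 fun w hi hj => ?_⟩
  rotate_left
  · by_cases ha : FreeAbove P S i
    · simp only [f, g, ha, hexcl i ha, if_true, if_false]
      exact Or.inr (by simp [grid])
    · by_cases hb : FreeBelow P S i
      · simp only [f, g, ha, hb, if_true, if_false]
        exact Or.inr (by simp [grid])
      · simp [f, g, ha, hb]
  · obtain e | ⟨h, e⟩ | ⟨h, e⟩ := hnodes i w hi <;>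
      obtain e' | ⟨h', e'⟩ | ⟨h', e'⟩ := hnodes j w hj <;> rw [e] at e'
    · exact hij (hinj i j e')
    · exact h'.2 (e' ▸ hocc i)
    · exact h'.2 (e' ▸ hocc i)
    · exact h.2 (e' ▸ hocc j)
    · exact hij (hinj i j (add_right_cancel e'))
    -- Expansions meeting from below and above would put two consecutive rows into `P`.
    · have h1 := hP _ h.1
      have h2 := congrArg Prod.snd e'
      have h3 := h'.1
      simp only [Prod.snd_add, Prod.snd_sub] at h2
      rw [h2] at h1
      exact h1 h3
    · exact h.2 (e' ▸ hocc j)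
    · have h1 := hP _ h'.1
      have h2 := congrArg Prod.snd e'
      have h3 := h.1
      simp only [Prod.snd_add, Prod.snd_sub] at h2
      rw [← h2] at h1
      exact h1 h3
    · exact hij (hinj i j (sub_left_injective e'))
  have hUa : ∀ i, FreeAbove P S i → U.tail i = S.tail i ∧ U.head i = S.tail i + (0, 1) :=
    fun i h => ⟨if_neg (hexcl i h), if_pos h⟩
  have hUb : ∀ i, FreeBelow P S i → U.tail i = S.tail i - (0, 1) ∧ U.head i = S.tail i :=
    fun i h => ⟨if_pos h, if_neg fun h' => hexcl i h' h⟩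
  have hUn : ∀ i, ¬ FreeAbove P S i → ¬ FreeBelow P S i →
      U.tail i = S.tail i ∧ U.head i = S.tail i := fun i h h' => ⟨if_neg h', if_neg h⟩
  have hUc : ∀ i, U.Contracted i ↔ ¬ FreeAbove P S i ∧ ¬ FreeBelow P S i := by
    intro i
    constructor
    · intro h
      constructor
      · intro ha
        rw [Config.Contracted, (hUa i ha).1, (hUa i ha).2] at h
        simp [Prod.ext_iff] at h
      · intro hb
        rw [Config.Contracted, (hUb i hb).1, (hUb i hb).2] at h
        simp [Prod.ext_iff] at h
    · rintro ⟨ha, hb⟩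
      rw [Config.Contracted, (hUn i ha hb).1, (hUn i ha hb).2]
  have hct : ∀ i, U.Contracted i → U.tail i = S.tail i := fun i h =>
    (hUn i ((hUc i).1 h).1 ((hUc i).1 h).2).1
  have htail : ∀ i, S.tail i ∈ U.nodes i := by
    intro i
    by_cases ha : FreeAbove P S i
    · exact Or.inl (hUa i ha).1.symm
    by_cases hb : FreeBelow P S i
    · exact Or.inr (hUb i hb).2.symm
    · exact Or.inl (hUn i ha hb).1.symm
  have hoccS : ∀ v ∈ S.occupied, ∃ j, S.tail j = v := fun v ⟨j, hj⟩ =>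
    ⟨j, ((hc j).eq_tail hj).symm⟩
  let act : ι → Action ι := fun i => if FreeAbove P S i ∨ FreeBelow P S i then .expand else .idle
  refine ⟨U, ⟨act, roundBy_of_static hconn (fun i hi => ?_) (fun i hi => ?_) (fun i hi => ?_)
    (fun i j hi => ?_), fun i => ⟨fun ha => ⟨if_pos (Or.inl ha), hUa i ha⟩,
      fun hb => ⟨if_pos (Or.inr hb), hUb i hb⟩, fun ha hb => ⟨if_neg (by tauto), ?_⟩⟩⟩,
    ⟨fun i hi => ?_, fun i hi hiP => ?_, fun i hi hiP => ?_, ?_⟩, fun i => ?_, hct⟩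
  · by_cases h : FreeAbove P S i ∨ FreeBelow P S i
    · simp [act, h] at hi
    · rw [not_or] at h
      rw [(hUn i h.1 h.2).1, (hUn i h.1 h.2).2]
      exact ⟨rfl, hc i⟩
  · by_cases h : FreeAbove P S i ∨ FreeBelow P S i
    · exact ⟨hc i, by rw [hUc]; tauto, htail i⟩
    · simp [act, h] at hi
  · by_cases h : FreeAbove P S i ∨ FreeBelow P S i <;> simp [act, h] at hi
  · by_cases h : FreeAbove P S i ∨ FreeBelow P S i <;> simp [act, h] at hi
  · rw [(hUn i ha hb).1, (hUn i ha hb).2]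
    exact ⟨rfl, hc i⟩
  · rw [hUc, not_and_or, not_not, not_not] at hi
    obtain ha | hb := hi
    · rw [(hUa i ha).1, (hUa i ha).2]
      exact ⟨ha.1, rfl⟩
    · rw [(hUb i hb).1, (hUb i hb).2]
      exact ⟨hb.1, (sub_add_cancel _ _).symm⟩
  · rw [hct i hi] at hiP ⊢
    obtain ⟨ha, -⟩ := (hUc i).1 hi
    obtain ⟨j, hj⟩ := hoccS _ (by_contra fun h => ha ⟨hiP, h⟩)
    have hja : ¬ FreeAbove P S j := by
      rintro ⟨h, -⟩
      rw [hj] at h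
      exact hP _ hiP h
    have hjb : ¬ FreeBelow P S j := by
      rintro ⟨-, h⟩
      rw [hj, add_sub_cancel_right] at h
      exact h (hocc i)
    exact ⟨j, (hUn j hja hjb).1.trans hj, (hUn j hja hjb).2.trans hj⟩
  · rw [hct i hi] at hiP ⊢
    obtain ⟨-, hb⟩ := (hUc i).1 hi
    obtain ⟨j, hj⟩ := hoccS _ (by_contra fun h => hb ⟨hiP, h⟩)
    have hja : ¬ FreeAbove P S j := by
      rintro ⟨-, h⟩
      rw [hj, sub_add_cancel] at h
      exact h (hocc i)
    have hjb : ¬ FreeBelow P S j := by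
      rintro ⟨h, -⟩
      rw [hj] at h
      have := hP _ h
      rw [sub_add_cancel] at this
      exact this hiP
    exact ⟨j, (hUn j hja hjb).1.trans hj, (hUn j hja hjb).2.trans hj⟩
  · refine hconn.of_subset ?_ ?_
    · intro v hv
      obtain ⟨i, rfl⟩ := hoccS v hv
      exact ⟨i, htail i⟩
    · rintro v ⟨i, hi⟩
      obtain rfl | ⟨-, rfl⟩ | ⟨-, rfl⟩ := hnodes i v hi
      · exact Or.inl (hocc i)
      · exact Or.inr ⟨_, hocc i, by simp [grid]⟩
      · exact Or.inr ⟨_, hocc i, by simp [grid]⟩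
  · by_cases ha : FreeAbove P S i
    · rw [(hUa i ha).1]
    by_cases hb : FreeBelow P S i
    · have := rowShift_succ_of_mem hb.1
      rw [sub_add_cancel] at this
      rw [(hUb i hb).1, this]
      rfl
    · rw [(hUn i ha hb).1]

/-! ### Finding chains and running the tunneling steps -/

lemma finite_occupied [Finite ι] (S : Config ι) : S.occupied.Finite := by
  have : S.occupied = ⋃ i, S.nodes i := by
    ext v
    simp [Config.occupied]
  rw [this]
  exact Set.finite_iUnion fun i => by simp [Config.nodes]

lemma IsPairColumn.mem_occupied {S : Config ι} {r c : ℤ} (h : IsPairColumn S r c) :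
    (c, r) ∈ S.occupied := by
  obtain ⟨i, _, hi, -⟩ := h
  exact ⟨i, hi.mem⟩

lemma finite_pairColumns [Finite ι] (S : Config ι) (r : ℤ) : {c | IsPairColumn S r c}.Finite :=
  ((finite_occupied S).preimage (f := fun c : ℤ => ((c, r) : Node))
    (fun _ _ _ _ e => congrArg Prod.fst e)).subset fun _ h => IsPairColumn.mem_occupied h

lemma Aligned.exists_expanded {P : Finset ℤ} (hP : ∀ r ∈ P, r + 1 ∉ P) {U : Config ι}
    (hU : Aligned P U) {r c : ℤ} (hr : r ∈ P) (hc : (c, r) ∈ U.occupied)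
    (hp : ¬ IsPairColumn U r c) : ∃ i, U.tail i = (c, r) ∧ U.head i = (c, r + 1) := by
  obtain ⟨i, hi⟩ := hc
  have hexp : ¬ U.Contracted i := by
    intro h
    have ht := h.eq_tail hi
    obtain ⟨j, hj⟩ := hU.above i h (by rw [← ht]; exact hr)
    rw [← ht] at hj
    exact hp ⟨i, j, ⟨ht.symm, by rw [← show U.tail i = U.head i from h, ht]⟩, by simpa using hj⟩
  obtain ⟨h1, h2⟩ := hU.vertical i hexp
  refine ⟨i, ?_⟩
  obtain e | e := hi
  · rw [h2, ← e]
    simp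
  · exfalso
    have e2 := congrArg Prod.snd ((show (c, r) = U.head i from e).trans h2)
    simp only [Prod.snd_add] at e2
    exact hP _ h1 (e2 ▸ hr)

lemma Aligned.mem_occupied_of_above {P : Finset ℤ} (hP : ∀ r ∈ P, r + 1 ∉ P) {U : Config ι}
    (hU : Aligned P U) {r c : ℤ} (hr : r ∈ P) (hc : (c, r + 1) ∈ U.occupied) :
    (c, r) ∈ U.occupied := by
  obtain ⟨i, hi⟩ := hc
  by_cases h : U.Contracted i
  · have ht := h.eq_tail hi
    obtain ⟨j, hj⟩ := hU.below i h (by rw [← ht]; simpa using hr)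
    rw [← ht] at hj
    exact ⟨j, by simpa using hj.mem⟩
  · obtain ⟨h1, h2⟩ := hU.vertical i h
    obtain e | e := hi
    · rw [← e] at h1
      exact absurd h1 (hP r hr)
    · refine ⟨i, Or.inl ?_⟩
      have e2 := (show (c, r + 1) = U.head i from e).trans h2
      simp only [Prod.ext_iff, Prod.snd_add, Prod.fst_add] at e2 ⊢
      omega

lemma Aligned.exists_chain [Finite ι] {P : Finset ℤ} (hP : ∀ r ∈ P, r + 1 ∉ P) {U : Config ι}
    (hU : Aligned P U) {r : ℤ} (hr : r ∈ activeRows P U) : ∃ ch : Chain ι, IsChain U r ch := by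
  classical
  obtain ⟨hrP, hne⟩ := hr
  obtain ⟨col, ⟨i₀, i₁, h₀, h₁⟩, hmax⟩ : ∃ col, IsPairColumn U r col ∧
      ∀ c, IsPairColumn U r c → c ≤ col := by
    have hfin := finite_pairColumns U r
    have hne' : hfin.toFinset.Nonempty := by simpa [Finset.Nonempty] using hne
    refine ⟨hfin.toFinset.max' hne', ?_, fun c hc => le_max' _ _ (by simpa using hc)⟩
    simpa using max'_mem _ hne'
  have hex : ∃ k : ℕ, (col + k + 1, r) ∉ U.occupied := by
    by_contra! hcon
    refine Set.infinite_of_injective_forall_mem (f := fun k : ℕ => ((col + k + 1, r) : Node))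
      (fun k k' e => ?_) hcon (finite_occupied U)
    have := congrArg Prod.fst e
    simp only at this
    omega
  have hlink : ∀ m : ℕ, ∃ i, (m = 0 → i = i₀) ∧ (m = 1 → i = i₁) ∧ ∀ j < Nat.find hex, m = j + 2 →
      U.tail i = (col + j + 1, r) ∧ U.head i = (col + j + 1, r + 1) := by
    intro m
    by_cases hm : ∃ j < Nat.find hex, m = j + 2
    · obtain ⟨j, hj, rfl⟩ := hm
      obtain ⟨i, hi⟩ := hU.exists_expanded hP hrP (not_not.1 (Nat.find_min hex hj))
        fun hp => by have := hmax _ hp; omega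
      refine ⟨i, by omega, by omega, fun j' _ e => ?_⟩
      obtain rfl : j = j' := by omega
      exact hi
    · by_cases h0 : m = 0
      · exact ⟨i₀, fun _ => rfl, by omega, fun j hj e => absurd ⟨j, hj, e⟩ hm⟩
      -- `i₁` also serves as the default link beyond the end of the chain.
      · exact ⟨i₁, by omega, fun _ => rfl, fun j hj e => absurd ⟨j, hj, e⟩ hm⟩
  choose link hl0 hl1 hl using hlink
  refine ⟨⟨col, Nat.find hex, link⟩, ?_, ?_, fun c hc hp => ?_, fun j hj => hl _ j hj rfl,
    Nat.find_spec hex, fun h => Nat.find_spec hex (hU.mem_occupied_of_above hP hrP h)⟩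
  · simpa only [hl0 0 rfl] using h₀
  · simpa only [hl1 1 rfl] using h₁
  · have := hmax c hp
    simp only at hc
    omega

/-- All links end up expanded, so every amoebot contracted afterwards was untouched. No new pair
column appears, and in each active pair of rows the column where the chain starts is lost. -/
lemma Aligned.exists_tunnelStep [Finite ι] {P : Finset ℤ} (hP : ∀ r ∈ P, r + 1 ∉ P)
    {U : Config ι} (hU : Aligned P U) (hact : (activeRows P U).Nonempty) :
    ∃ U', TunnelStep P U U' ∧ Aligned P U' ∧
      (∀ i, rowShift P (U'.tail i).2 = rowShift P (U.tail i).2) ∧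
      ∀ r ∈ P, {c | IsPairColumn U' r c}.ncard ≤ {c | IsPairColumn U r c}.ncard - 1 := by
  have hch : ∀ r, ∃ ch : Chain ι, r ∈ activeRows P U → IsChain U r ch := by
    -- A chain of some active row serves as the irrelevant value at inactive rows.
    obtain ⟨r₀, hr₀⟩ := hact
    obtain ⟨ch₀, -⟩ := hU.exists_chain hP hr₀
    intro r
    by_cases hr : r ∈ activeRows P U
    · obtain ⟨ch, hch⟩ := hU.exists_chain hP hr
      exact ⟨ch, fun _ => hch⟩
    · exact ⟨ch₀, fun h => absurd h hr⟩
  choose ch hch using hch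
  have h : ChainSystem (activeRows P U) ch U := ⟨fun r hr hr' => hP r hr.1 hr'.1, hch⟩
  obtain ⟨S₁, S₂, S₃, S₄, U', h1, h2, h3, h4, h5, hL⟩ := h.exists_final hU.connected
  have hcon : ∀ i, U'.Contracted i → ¬ InChain (activeRows P U) ch i := by
    rintro i hi ⟨r, hr, m, hm, rfl⟩
    rw [hL.contracted_iff hr hm] at hi
    simp [thirdTail, finalHead] at hi
  have hsame : ∀ i, U'.Contracted i →
      U.Contracted i ∧ U'.tail i = U.tail i ∧ U'.head i = U.head i := by
    intro i hi
    obtain ⟨e1, e2⟩ := hL.other i (hcon i hi)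
    exact ⟨e1.symm.trans (Eq.trans hi e2), e1, e2⟩
  have hpos : ∀ j, U.Contracted j → InChain (activeRows P U) ch j → ∃ r ∈ activeRows P U,
      U.tail j = ((ch r).col, r) ∨ U.tail j = ((ch r).col, r + 1) := by
    rintro j hj ⟨r, hr, m, hm, rfl⟩
    refine ⟨r, hr, ?_⟩
    rw [h.layout_start.contracted_iff hr hm] at hj
    obtain ⟨g0, g1, -⟩ := hch r hr
    obtain rfl | rfl : m = 0 ∨ m = 1 := by
      unfold startTail startHead at hj
      split_ifs at hj <;> omega
    · exact Or.inl g0.1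
    · exact Or.inr g1.1
  -- The bound 3 puts `k` on the path for every chain length; only `k = 0, 1` are used.
  have hin : ∀ i, ∀ r ∈ activeRows P U, ∀ k ≤ 3, U.tail i = pathNode r (ch r).col k →
      InChain (activeRows P U) ch i := by
    intro i r hr k hk e
    obtain ⟨-, m, hm, e'⟩ := h.exists_link_of_mem hr (k := k) (by omega) (e ▸ U.tail_mem i)
    exact ⟨r, hr, m, hm, e'⟩
  refine ⟨U', ⟨ch, hch, S₁, S₂, S₃, S₄, h1, h2, h3, h4, h5⟩, ⟨fun i hi => ?_, fun i hi hiP => ?_,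
    fun i hi hiP => ?_, h.gridConnected placement_final hL hU.connected⟩, fun i => ?_,
    fun r hr => ?_⟩
  · by_cases hc : InChain (activeRows P U) ch i
    · obtain ⟨r, hr, m, hm, rfl⟩ := hc
      rw [hL.tail r hr m hm, hL.head r hr m hm]
      simp only [pathNode, thirdTail, finalHead, Prod.mk_add_mk, Prod.ext_iff]
      refine ⟨?_, by omega, by omega⟩
      rw [show 2 * m % 2 = 0 by omega, Nat.cast_zero, add_zero]
      exact hr.1
    · rw [(hL.other i hc).1, (hL.other i hc).2]
      refine hU.vertical i fun hi' => hi ?_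
      rw [Config.Contracted, (hL.other i hc).1, (hL.other i hc).2]
      exact hi'
  · obtain ⟨g1, g2, g3⟩ := hsame i hi
    rw [g2] at hiP ⊢
    obtain ⟨j, hj⟩ := hU.above i g1 hiP
    have hjc : ¬ InChain (activeRows P U) ch j := by
      intro hjc
      obtain ⟨r, hr, e | e⟩ := hpos j hj.contracted hjc <;> rw [hj.1] at e <;>
        simp only [Prod.ext_iff, Prod.fst_add, Prod.snd_add] at e
      · exact hP _ hiP (e.2 ▸ hr.1)
      · refine hcon i hi (hin i r hr 0 (by omega) ?_)
        simp only [pathNode, Prod.ext_iff]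
        omega
    obtain ⟨e1, e2⟩ := hL.other j hjc
    exact ⟨j, e1.trans hj.1, e2.trans hj.2⟩
  · obtain ⟨g1, g2, g3⟩ := hsame i hi
    rw [g2] at hiP ⊢
    obtain ⟨j, hj⟩ := hU.below i g1 hiP
    have hjc : ¬ InChain (activeRows P U) ch j := by
      intro hjc
      obtain ⟨r, hr, e | e⟩ := hpos j hj.contracted hjc <;> rw [hj.1] at e <;>
        simp only [Prod.ext_iff, Prod.fst_sub, Prod.snd_sub] at e
      · refine hcon i hi (hin i r hr 1 (by omega) ?_)
        simp only [pathNode, Prod.ext_iff]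
        omega
      · exact hP _ hr.1 (e.2 ▸ hiP)
    obtain ⟨e1, e2⟩ := hL.other j hjc
    exact ⟨j, e1.trans hj.1, e2.trans hj.2⟩
  · by_cases hc : InChain (activeRows P U) ch i
    · obtain ⟨r, hr, m, hm, rfl⟩ := hc
      have key : ∀ k : ℕ, rowShift P (r + (k % 2 : ℕ)) = rowShift P r := by
        intro k
        obtain e | e := Nat.mod_two_eq_zero_or_one k
        · simp [e]
        · rw [e, Nat.cast_one, rowShift_succ_of_mem hr.1]
      rw [hL.tail r hr m hm, h.layout_start.tail r hr m hm]
      exact (key _).trans (key _).symm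
    · rw [(hL.other i hc).1]
  · have hsub : ∀ c, IsPairColumn U' r c → IsPairColumn U r c := by
      rintro c ⟨i, j, hi, hj⟩
      obtain ⟨-, e1, e2⟩ := hsame i hi.contracted
      obtain ⟨-, e3, e4⟩ := hsame j hj.contracted
      exact ⟨i, j, ⟨e1 ▸ hi.1, e2 ▸ hi.2⟩, ⟨e3 ▸ hj.1, e4 ▸ hj.2⟩⟩
    by_cases hra : r ∈ activeRows P U
    · refine Nat.le_sub_one_of_lt (Set.ncard_lt_ncard ⟨hsub, fun hle => ?_⟩
        (finite_pairColumns U r))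
      obtain ⟨g0, g1, -⟩ := hch r hra
      obtain ⟨i, -, hi, -⟩ : IsPairColumn U' r (ch r).col := hle ⟨_, _, g0, g1⟩
      refine hcon i hi.contracted (hin i r hra 0 (by omega) ?_)
      rw [← (hsame i hi.contracted).2.1, hi.1]
      simp [pathNode]
    · have : {c | IsPairColumn U' r c} = ∅ :=
        Set.eq_empty_of_forall_notMem fun c hc => hra ⟨hr, c, hsub c hc⟩
      rw [this]
      simp

/-- Since all active pairs of rows tunnel in parallel, one step lowers the maximum number of pair
columns. -/
lemma Aligned.exists_tunnelSteps [Finite ι] {P : Finset ℤ} (hP : ∀ r ∈ P, r + 1 ∉ P) (b : ℕ)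
    {U₀ : Config ι} (hU₀ : Aligned P U₀) (hb : ∀ r ∈ P, {c | IsPairColumn U₀ r c}.ncard ≤ b) :
    ∃ t ≤ b, ∃ U : ℕ → Config ι, U 0 = U₀ ∧
      (∀ s < t, (activeRows P (U s)).Nonempty ∧ TunnelStep P (U s) (U (s + 1))) ∧
      activeRows P (U t) = ∅ ∧ Aligned P (U t) ∧
      ∀ i, rowShift P ((U t).tail i).2 = rowShift P (U₀.tail i).2 := by
  induction b generalizing U₀ with
  | zero =>
    refine ⟨0, le_rfl, fun _ => U₀, rfl, by simp, ?_, hU₀, fun _ => rfl⟩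
    refine Set.eq_empty_of_forall_notMem ?_
    rintro r ⟨hr, c, hc⟩
    have h0 := Nat.le_zero.1 (hb r hr)
    rw [Set.ncard_eq_zero (finite_pairColumns U₀ r)] at h0
    exact (Set.ext_iff.1 h0 c).1 hc
  | succ b ih =>
    obtain hempty | hne := (activeRows P U₀).eq_empty_or_nonempty
    · exact ⟨0, by omega, fun _ => U₀, rfl, by simp, hempty, hU₀, fun _ => rfl⟩
    obtain ⟨U₁, hstep, hU₁, hrow, hcols⟩ := hU₀.exists_tunnelStep hP hne
    obtain ⟨t, ht, U, h0, hsteps, hend, hal, hrow'⟩ := ih hU₁ fun r hr => by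
      have := hb r hr
      have := hcols r hr
      omega
    refine ⟨t + 1, by omega, fun s => Nat.casesOn s U₀ U, rfl, ?_, hend, hal,
      fun i => (hrow' i).trans (hrow i)⟩
    rintro (_ | s) hs
    · refine ⟨hne, ?_⟩
      change TunnelStep P U₀ (U 0)
      rwa [h0]
    · exact hsteps s (by omega)

/-- Without pair columns every occupied node of a pair of rows belongs to a vertical expanded
amoebot, so `collapse` identifies only nodes of the same amoebot. -/
lemma Aligned.exists_contractPhase {P : Finset ℤ} (hP : ∀ r ∈ P, r + 1 ∉ P) {U : Config ι}
    (hU : Aligned P U) (hact : activeRows P U = ∅) :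
    ∃ S', ContractPhase P U S' ∧ S' ∈ Arbitrary ι ∧
      ∀ i, (S'.tail i).2 = rowShift P (U.tail i).2 := by
  classical
  have hexp : ∀ i, U.Contracted i → (U.tail i).2 ∉ P := by
    intro i hi hiP
    obtain ⟨j, hj⟩ := hU.above i hi hiP
    rw [show U.tail i + (0, 1) = ((U.tail i).1, (U.tail i).2 + 1) from
      Prod.ext (add_zero _) rfl] at hj
    have : (U.tail i).2 ∈ activeRows P U := ⟨hiP, (U.tail i).1, i, j, ⟨rfl, Eq.symm hi⟩, hj⟩
    rw [hact] at this
    exact this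
  have hcol : ∀ v, collapse P v = (v.1, rowShift P v.2) := fun _ => rfl
  have hhead : ∀ i, collapse P (U.head i) = collapse P (U.tail i) := by
    intro i
    by_cases hi : U.Contracted i
    · rw [show U.head i = U.tail i from Eq.symm hi]
    · obtain ⟨h1, h2⟩ := hU.vertical i hi
      rw [h2, hcol, hcol, Prod.fst_add, Prod.snd_add, rowShift_succ_of_mem h1, add_zero]
  have hmem : ∀ i, ∀ u ∈ U.nodes i, collapse P u = collapse P (U.tail i) := by
    rintro i u (rfl | rfl)
    · rfl
    · exact hhead i
  have hstep : ∀ i j, (U.tail j).1 = (U.tail i).1 → (U.tail j).2 = (U.tail i).2 + 1 →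
      (U.tail i).2 ∈ P → i = j := by
    intro i j h1 h2 hiP
    have hi : ¬ U.Contracted i := fun hi => hexp i hi hiP
    refine U.eq_of_mem_nodes (v := U.tail j) (Or.inr ?_) (U.tail_mem j)
    change U.tail j = U.head i
    rw [(hU.vertical i hi).2]
    exact Prod.ext (by simpa using h1) h2
  have hinj : ∀ i j, collapse P (U.tail i) = collapse P (U.tail j) → i = j := by
    intro i j e
    rw [hcol, hcol, Prod.mk.injEq] at e
    obtain ⟨e1, e2⟩ := e
    obtain hlt | heq | hlt := lt_trichotomy (U.tail i).2 (U.tail j).2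
    · obtain ⟨h1, h2⟩ := eq_of_rowShift_eq hP hlt e2
      exact hstep i j e1.symm h1 h2
    · exact U.eq_of_mem_nodes (U.tail_mem i) (Prod.ext e1 heq ▸ U.tail_mem j)
    · obtain ⟨h1, h2⟩ := eq_of_rowShift_eq hP hlt e2.symm
      exact (hstep j i e1 h1 h2).symm
  let S' : Config ι := ⟨fun i => collapse P (U.tail i), fun i => collapse P (U.tail i),
    fun _ => Or.inl rfl, fun i j hij => by
      rw [Set.pair_eq_singleton, Set.pair_eq_singleton, Set.disjoint_singleton]
      exact fun e => hij (hinj i j e)⟩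
  -- The bonds between the two rows of a pair are released, since merging would change their
  -- orientation.
  let R : SimpleGraph Node :=
    { Adj := fun u v => U.bondGraph.Adj u v ∧ collapse P v - collapse P u = v - u
      symm := ⟨fun u v h => ⟨h.1.symm, by rw [← neg_sub, h.2, neg_sub]⟩⟩
      loopless := ⟨fun u h => h.1.ne rfl⟩ }
  have hsame : ∀ u v, (gridOn U.occupied).Adj u v →
      rowShift P v.2 - rowShift P u.2 = v.2 - u.2 → (U.bodyGraph ⊔ R).Adj u v := by
    intro u v huv hs
    rw [← U.bodyGraph_sup_bondGraph] at huv
    refine huv.imp id fun hb => ⟨hb, ?_⟩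
    rw [hcol, hcol]
    exact Prod.ext rfl hs
  have hup : ∀ u v, (gridOn U.occupied).Adj u v → v.2 = u.2 + 1 →
      (U.bodyGraph ⊔ R).Reachable u v := by
    rintro ⟨a, b⟩ ⟨c, d⟩ huv (rfl : d = b + 1)
    by_cases hb : b ∈ P
    · obtain ⟨hadj, ⟨i, hi⟩, hv⟩ := huv
      have hcase := grid_adj_iff.1 hadj
      have hi' : ¬ U.Contracted i := by
        intro h
        have := hexp i h
        rw [← h.eq_tail hi] at this
        exact this hb
      obtain ⟨h1, h2⟩ := hU.vertical i hi'
      have htail : U.tail i = (a, b) := by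
        obtain e | e := hi
        · exact e.symm
        · have e2 := congrArg Prod.snd ((show (a, b) = U.head i from e).trans h2)
          simp only [Prod.snd_add] at e2
          exact absurd (e2 ▸ hb) (hP _ h1)
      rw [htail] at h2
      have hmid : ((a, b + 1) : Node) ∈ U.nodes i := Or.inr (by rw [h2]; simp)
      have r1 : (U.bodyGraph ⊔ R).Reachable (a, b) (a, b + 1) :=
        SimpleGraph.Adj.reachable (Or.inl ⟨by simp, i, hi, hmid⟩)
      obtain rfl | rfl : c = a ∨ c = a - 1 := by omega
      -- The grid edge lies inside the body; the diagonal one is replaced by the body followed by a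
      -- horizontal edge.
      · exact r1
      · exact r1.trans (SimpleGraph.Adj.reachable
          (hsame _ _ ⟨grid_adj_iff.2 (by omega), ⟨i, hmid⟩, hv⟩ (by simp)))
    · refine SimpleGraph.Adj.reachable (hsame _ _ huv ?_)
      have := rowShift_succ P b
      rw [if_neg hb] at this
      simp only
      omega
  have hedge : ∀ u v, (gridOn U.occupied).Adj u v → (U.bodyGraph ⊔ R).Reachable u v := by
    rintro ⟨a, b⟩ ⟨c, d⟩ huv
    obtain h | h | h : d = b ∨ d = b + 1 ∨ b = d + 1 := by
      have := grid_adj_iff.1 huv.1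
      omega
    · subst h
      exact SimpleGraph.Adj.reachable (hsame _ _ huv (by simp))
    · exact hup _ _ huv h
    · exact (hup _ _ huv.symm h).symm
  have hconR : U.ConnectedBy R := fun u hu v hv =>
    reachable_of_adj_reachable hedge (hU.connected u hu v hv)
  let act : ι → Action ι := fun i => if U.Contracted i then .idle else .contract
  have hround : RoundBy act U S' := by
    refine ⟨R, fun u _ => collapse P u, fun u v h => h.1, hconR, fun u v h => h.2,
      fun i hi => ?_, fun i hi => ?_, fun i hi => ?_, fun i j hi => ?_⟩
    all_goals by_cases hc : U.Contracted i
    · refine ⟨collapse P (U.tail i) - U.tail i, (add_sub_cancel _ _).symm, ?_, fun u hu v _ => ?_⟩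
      · rw [← show U.tail i = U.head i from hc]
        exact (add_sub_cancel _ _).symm
      · rw [hc.eq_tail hu]
        exact (add_sub_cancel _ _).symm
    · simp [act, hc] at hi
    · simp [act, hc] at hi
    · simp [act, hc] at hi
    · simp [act, hc] at hi
    · exact ⟨hc, rfl, fun u hu v _ => Or.inl (hmem i u hu)⟩
    · simp [act, hc] at hi
    · simp [act, hc] at hi
  have hocc : S'.occupied = collapse P '' U.occupied := by
    ext v
    constructor
    · rintro ⟨i, rfl | rfl⟩ <;> exact ⟨U.tail i, ⟨i, U.tail_mem i⟩, rfl⟩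
    · rintro ⟨u, ⟨i, hi⟩, rfl⟩
      exact ⟨i, Or.inl (hmem i u hi)⟩
  refine ⟨S', ⟨act, hround, fun i => ⟨fun hi => ⟨if_neg hi, rfl, (hhead i).symm⟩,
    fun hi => ⟨if_pos hi, rfl, (hhead i).symm⟩⟩⟩, ⟨fun _ => rfl, ?_⟩, fun _ => rfl⟩
  rw [S'.connectedBy_bondGraph_iff, hocc]
  refine hU.connected.image _ ?_
  rintro ⟨a, b⟩ - ⟨c, d⟩ - hadj
  have h1 := rowShift_succ P b
  have h2 := rowShift_succ P d
  have hcase := grid_adj_iff.1 hadj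
  simp only [hcol, Prod.mk.injEq, grid_adj_iff]
  obtain rfl | rfl | rfl : d = b ∨ d = b + 1 ∨ b = d + 1 := by omega
  · omega
  · split_ifs at h1 <;> omega
  · split_ifs at h2 <;> omega

/-! ### Counting rows -/

section Rows

variable {n : ℕ}

/-- The non-empty rows of a structure of contracted amoebots. -/
def rows (S : Config (Fin n)) : Finset ℤ := univ.image fun i => (S.tail i).2

/-- The rows with less than `√n` amoebots. -/
noncomputable def smallRows (S : Config (Fin n)) : Finset ℤ :=
  (rows S).filter fun y => (rowCount S y : ℝ) < √n

lemma rowCount_eq {S : Config (Fin n)} (hS : ∀ i, S.Contracted i) (y : ℤ) :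
    rowCount S y = (univ.filter fun i => (S.tail i).2 = y).card := by
  rw [rowCount, ← Set.ncard_coe_finset]
  congr 1
  ext i
  simp only [coe_filter, mem_univ, true_and, Set.mem_ofPred_eq]
  constructor
  · rintro ⟨v, hv, rfl⟩
    rw [(hS i).eq_tail hv]
  · exact fun h => ⟨_, S.tail_mem i, h⟩

lemma rowCount_pos_iff {S : Config (Fin n)} (hS : ∀ i, S.Contracted i) {y : ℤ} :
    0 < rowCount S y ↔ y ∈ rows S := by
  simp [rowCount_eq hS, card_pos, Finset.Nonempty, rows]

lemma card_rows_le (S : Config (Fin n)) : (rows S).card ≤ n := by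
  simpa [rows] using card_image_le (s := univ) (f := fun i => (S.tail i).2)

lemma numRows_eq {S : Config (Fin n)} (hS : ∀ i, S.Contracted i) :
    numRows S = (rows S).card := by
  rw [numRows, ← Set.ncard_coe_finset]
  congr 1
  ext y
  simp only [Set.mem_image, rows, coe_image, coe_univ, Set.image_univ, Set.mem_range]
  constructor
  · rintro ⟨v, ⟨i, hi⟩, rfl⟩
    exact ⟨i, by rw [(hS i).eq_tail hi]⟩
  · rintro ⟨i, rfl⟩
    exact ⟨S.tail i, ⟨i, S.tail_mem i⟩, rfl⟩

lemma exists_adjacent_row {S : Config (Fin n)} (hS : S ∈ Arbitrary (Fin n)) {y z : ℤ}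
    (hy : y ∈ rows S) (hz : z ∈ rows S) (hne : z ≠ y) : y + 1 ∈ rows S ∨ y - 1 ∈ rows S := by
  have hconn := S.connectedBy_bondGraph_iff.1 hS.2
  obtain ⟨i, -, rfl⟩ := mem_image.1 hy
  obtain ⟨j, -, rfl⟩ := mem_image.1 hz
  have hrow : ∀ w ∈ S.occupied, w.2 ∈ rows S := by
    rintro w ⟨k, hk⟩
    rw [(hS.1 k).eq_tail hk]
    exact mem_image_of_mem _ (mem_univ k)
  obtain ⟨w, hw, e⟩ | ⟨w, hw, e⟩ :=
    hconn.exists_adjacent_row ⟨i, S.tail_mem i⟩ ⟨j, S.tail_mem j⟩ hne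
  · exact Or.inl (e ▸ hrow w hw)
  · refine Or.inr ?_
    rw [← e, add_sub_cancel_right]
    exact hrow w hw

/-- Every pair of rows that is merged reduces the number of small rows. -/
lemma card_smallRows_add_card_le {S S' : Config (Fin n)} {P : Finset ℤ} (hP : IsPairing S P)
    (hS : ∀ i, S.Contracted i) (hS' : ∀ i, S'.Contracted i)
    (hrow : ∀ i, (S'.tail i).2 = rowShift P (S.tail i).2) :
    (smallRows S').card + P.card ≤ (smallRows S).card := by
  have hcount : ∀ y, rowCount S y ≤ rowCount S' (rowShift P y) := by
    intro y
    rw [rowCount_eq hS, rowCount_eq hS']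
    refine card_le_card fun i hi => ?_
    simp only [mem_filter, mem_univ, true_and] at hi ⊢
    rw [hrow, hi]
  -- `σ` picks a small row from each pair. These rows can be discarded without losing any small row
  -- after the merge.
  let σ : ℤ → ℤ := fun r => if r + 1 ∈ smallRows S then r + 1 else r
  have hσ : ∀ r, σ r = r ∨ σ r = r + 1 := fun r => by
    by_cases h : r + 1 ∈ smallRows S <;> simp [σ, h]
  have hσ_inj : ∀ r ∈ P, ∀ r' ∈ P, ∀ y, (y = r ∨ y = r + 1) → (y = r' ∨ y = r' + 1) → r = r' := by
    intro r hr r' hr' y h1 h2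
    have h3 : r' ≠ r + 1 := fun e => (hP r hr).1 (e ▸ hr')
    have h4 : r ≠ r' + 1 := fun e => (hP r' hr').1 (e ▸ hr)
    omega
  have hσ_mem : P.image σ ⊆ smallRows S := by
    intro y hy
    obtain ⟨r, hr, rfl⟩ := mem_image.1 hy
    by_cases h : r + 1 ∈ smallRows S
    · simp [σ, h]
    · obtain ⟨-, h1, h2, h3⟩ := hP r hr
      have h4 : ¬ (rowCount S (r + 1) : ℝ) < √n := fun hlt =>
        h (mem_filter.2 ⟨(rowCount_pos_iff hS).1 h2, hlt⟩)
      simp only [σ, if_neg h]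
      exact mem_filter.2 ⟨(rowCount_pos_iff hS).1 h1, h3.resolve_right h4⟩
  have hsub : smallRows S' ⊆ (smallRows S \ P.image σ).image (rowShift P) := by
    intro y' hy'
    obtain ⟨h1, h2⟩ := mem_filter.1 hy'
    obtain ⟨i, -, rfl⟩ := mem_image.1 h1
    rw [hrow i] at h2 ⊢
    have hsmall : ∀ y ∈ rows S, rowShift P y = rowShift P (S.tail i).2 → y ∈ smallRows S := by
      intro y hy e
      refine mem_filter.2 ⟨hy, lt_of_le_of_lt ?_ h2⟩
      rw [← e]
      exact_mod_cast hcount y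
    -- If a merged row is small, both of its rows were small, so the one not picked by `σ`
    -- represents it.
    by_cases hi : (S.tail i).2 ∈ P.image σ
    · obtain ⟨r, hr, e⟩ := mem_image.1 hi
      obtain ⟨-, g1, g2, -⟩ := hP r hr
      rw [rowCount_pos_iff hS] at g1 g2
      have hs := rowShift_succ_of_mem hr
      obtain ⟨y, hy, hyr, hyi, hshift⟩ : ∃ y ∈ rows S, (y = r ∨ y = r + 1) ∧ y ≠ (S.tail i).2 ∧
          rowShift P y = rowShift P (S.tail i).2 := by
        obtain e' | e' := hσ r <;> rw [← e, e']
        · exact ⟨r + 1, g2, Or.inr rfl, by omega, hs⟩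
        · exact ⟨r, g1, Or.inl rfl, by omega, hs.symm⟩
      refine mem_image.2 ⟨y, mem_sdiff.2 ⟨hsmall y hy hshift, fun hy' => ?_⟩, hshift⟩
      obtain ⟨r', hr', e''⟩ := mem_image.1 hy'
      have := hσ_inj r hr r' hr' y hyr (by rw [← e'']; exact hσ r')
      subst this
      exact hyi (e''.symm.trans e)
    · exact mem_image.2 ⟨_, mem_sdiff.2
        ⟨hsmall _ (mem_image_of_mem _ (mem_univ i)) rfl, hi⟩, rfl⟩
  have h1 := (card_le_card hsub).trans card_image_le
  have h2 := card_sdiff_add_card_eq_card hσ_mem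
  rw [card_image_of_injOn fun r hr r' hr' e =>
    hσ_inj r hr r' hr' (σ r) (hσ r) (by rw [e]; exact hσ r')] at h2
  omega

/-- In a maximum pairing, every small row is in or next to a pair. -/
lemma card_smallRows_le {S : Config (Fin n)} {P : Finset ℤ} (hP : IsMaximumPairing S P)
    (hS : S ∈ Arbitrary (Fin n)) (hne : P.Nonempty) : (smallRows S).card ≤ 4 * P.card := by
  obtain ⟨r₀, hr₀⟩ := hne
  have hsub : smallRows S ⊆ P.biUnion fun r => {r - 1, r, r + 1, r + 2} := by
    intro y hy
    by_contra hcon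
    have hfar : ∀ r ∈ P, y ≠ r - 1 ∧ y ≠ r ∧ y ≠ r + 1 ∧ y ≠ r + 2 := by
      simpa using hcon
    obtain ⟨hy1, hy2⟩ := mem_filter.1 hy
    have hr₀' := (rowCount_pos_iff hS.1).1 (hP.1 r₀ hr₀).2.1
    -- A small row far from all pairs could be paired with a neighbouring row, contradicting
    -- maximality.
    have hins : ∀ z, z ∉ P → (∀ r ∈ P, r + 1 ≠ z ∧ r ≠ z + 1) → z ∈ rows S → z + 1 ∈ rows S →
        (z = y ∨ z + 1 = y) → False := by
      intro z hz hz' h1 h2 h3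
      have hQ : IsPairing S (insert z P) := by
        intro r hr
        obtain rfl | hr := mem_insert.1 hr
        · refine ⟨?_, (rowCount_pos_iff hS.1).2 h1, (rowCount_pos_iff hS.1).2 h2, ?_⟩
          · rw [mem_insert, not_or]
            exact ⟨by omega, fun h => (hz' _ h).2 rfl⟩
          · exact h3.imp (fun e => by rwa [e]) fun e => by rwa [e]
        · refine ⟨?_, (hP.1 r hr).2⟩
          rw [mem_insert, not_or]
          exact ⟨(hz' r hr).1, (hP.1 r hr).1⟩
      have := hP.2 _ hQ
      rw [card_insert_of_notMem hz] at this
      omega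
    obtain h | h := exists_adjacent_row hS hy1 hr₀' (hfar r₀ hr₀).2.1.symm
    · refine hins y (fun h => (hfar y h).2.1 rfl) (fun r hr => ?_) hy1 h (Or.inl rfl)
      have := hfar r hr
      omega
    · refine hins (y - 1) (fun h => (hfar _ h).2.2.1 (by omega)) (fun r hr => ?_) h
        (by rwa [sub_add_cancel]) (Or.inr (sub_add_cancel _ _))
      have := hfar r hr
      omega
  have := (card_le_card hsub).trans (card_biUnion_le_card_mul P _ 4 fun r _ => card_le_four)
  omega

/-- When no rows can be paired, there are at most `√n` rows. -/
lemma card_rows_le_sqrt {S : Config (Fin n)} (hP : IsMaximumPairing S ∅)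
    (hS : S ∈ Arbitrary (Fin n)) : ((rows S).card : ℝ) ≤ √n := by
  obtain hle | hlt := Nat.lt_or_ge 1 (rows S).card |>.symm
  · obtain rfl | hn := Nat.eq_zero_or_pos n
    · have := card_rows_le S
      simp [Nat.le_zero.1 this]
    · have h1 : (1 : ℝ) ≤ √n := Real.one_le_sqrt.2 (by exact_mod_cast hn)
      exact le_trans (by exact_mod_cast hle) h1
  have hbad : ∀ z ∈ rows S, z + 1 ∈ rows S → √n ≤ rowCount S z ∧ √n ≤ rowCount S (z + 1) := by
    intro z h1 h2
    by_contra hcon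
    rw [not_and_or, not_le, not_le] at hcon
    have hQ : IsPairing S {z} := by
      intro r hr
      rw [mem_singleton] at hr
      subst hr
      exact ⟨by simp, (rowCount_pos_iff hS.1).2 h1, (rowCount_pos_iff hS.1).2 h2, hcon⟩
    simpa using hP.2 _ hQ
  have hlarge : ∀ y ∈ rows S, √n ≤ rowCount S y := by
    intro y hy
    obtain ⟨z, hz, hne⟩ := exists_mem_ne hlt y
    obtain h | h := exists_adjacent_row hS hy hz hne
    · exact (hbad y hy h).1
    · have := (hbad (y - 1) h (by rwa [sub_add_cancel])).2
      rwa [sub_add_cancel] at this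
  have hsum : ∑ y ∈ rows S, rowCount S y = n := by
    have := card_eq_sum_card_fiberwise (s := univ) (t := rows S) (f := fun i => (S.tail i).2)
      fun i _ => mem_image_of_mem _ (mem_univ i)
    rw [card_univ, Fintype.card_fin] at this
    exact (sum_congr rfl fun y _ => rowCount_eq hS.1 y).trans this.symm
  -- Every row has at least `√n` of the `n` amoebots.
  have hmul : (rows S).card * √n ≤ √n * √n := by
    rw [Real.mul_self_sqrt n.cast_nonneg]
    calc (rows S).card * √n = ∑ _y ∈ rows S, √n := by rw [sum_const, nsmul_eq_mul]
      _ ≤ ∑ y ∈ rows S, (rowCount S y : ℝ) := sum_le_sum hlarge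
      _ = n := by rw [← Nat.cast_sum, hsum]
  have hn : 0 < n := by
    have := card_rows_le S
    omega
  exact le_of_mul_le_mul_right hmul (Real.sqrt_pos.2 (by exact_mod_cast hn))

/-! ### Iterations of the algorithm -/

lemma exists_iteration {S : Config (Fin n)} (hS : S ∈ Arbitrary (Fin n)) {P : Finset ℤ}
    (hP : IsPairing S P) (hne : P.Nonempty) :
    ∃ t S', Iteration P t S S' ∧ (t : ℝ) < √n ∧ S' ∈ Arbitrary (Fin n) ∧
      ∀ i, (S'.tail i).2 = rowShift P (S.tail i).2 := by
  have hP' : ∀ r ∈ P, r + 1 ∉ P := fun r hr => (hP r hr).1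
  obtain ⟨U₀, hexp, hal, hrow, hcon⟩ := exists_expandPhase hP' hS
  have hcols : ∀ r ∈ P, ({c | IsPairColumn U₀ r c}.ncard : ℝ) < √n := by
    intro r hr
    -- Contracted amoebots have not moved since `S`, so the pair columns inject into either row of
    -- the pair.
    have key : ∀ y, (∀ c, IsPairColumn U₀ r c → ∃ i, U₀.ContractedAt i (c, y)) →
        {c | IsPairColumn U₀ r c}.ncard ≤ rowCount S y := by
      intro y hy
      obtain hempty | ⟨c₀, hc₀⟩ := Set.eq_empty_or_nonempty {c | IsPairColumn U₀ r c}
      · simp [hempty]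
      have : Nonempty (Fin n) := ⟨(hy c₀ hc₀).choose⟩
      choose! f hf using hy
      refine Set.ncard_le_ncard_of_injOn f (fun c hc => ?_) (fun c hc c' hc' e => ?_)
        (Set.toFinite _)
      · have h1 := (hcon _ (hf c hc).contracted).symm.trans (hf c hc).1
        exact ⟨_, S.tail_mem _, by rw [h1]⟩
      · have h1 := (hf c hc).1
        rw [e, (hf c' hc').1] at h1
        exact (congrArg Prod.fst h1).symm
    have h1 := key r fun c ⟨i, _, hi, _⟩ => ⟨i, hi⟩
    have h2 := key (r + 1) fun c ⟨_, j, _, hj⟩ => ⟨j, hj⟩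
    obtain h3 | h3 := (hP r hr).2.2.2
    · exact lt_of_le_of_lt (by exact_mod_cast h1) h3
    · exact lt_of_le_of_lt (by exact_mod_cast h2) h3
  obtain ⟨r₀, hr₀⟩ := hne
  have hpos : 0 < ⌈√(n : ℝ)⌉₊ := Nat.ceil_pos.2 (lt_of_le_of_lt (Nat.cast_nonneg _) (hcols r₀ hr₀))
  obtain ⟨t, ht, U, h0, hsteps, hend, hal', hrow'⟩ :=
    hal.exists_tunnelSteps hP' (⌈√(n : ℝ)⌉₊ - 1) fun r hr =>
      Nat.le_sub_one_of_lt (Nat.lt_ceil.2 (hcols r hr))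
  obtain ⟨S', hcontract, hS', hrow''⟩ := hal'.exists_contractPhase hP' hend
  exact ⟨t, S', ⟨U, by rwa [h0], hsteps, hend, hcontract⟩, Nat.lt_ceil.1 (by omega), hS',
    fun i => by rw [hrow'', hrow', hrow]⟩

/-- The algorithm terminates after a number of iterations that is logarithmic in the number of
small rows. -/
lemma exists_iterations {pairing : Config (Fin n) → Finset ℤ}
    (hmax : ∀ T ∈ Arbitrary (Fin n), IsMaximumPairing T (pairing T)) {S : Config (Fin n)}
    (hS : S ∈ Arbitrary (Fin n)) :
    ∃ (K : ℕ) (V : ℕ → Config (Fin n)) (t : ℕ → ℕ), V 0 = S ∧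
      (∀ k < K, (pairing (V k)).Nonempty ∧ Iteration (pairing (V k)) (t k) (V k) (V (k + 1)) ∧
        (t k : ℝ) < √n) ∧
      pairing (V K) = ∅ ∧ V K ∈ Arbitrary (Fin n) ∧
      (K = 0 ∨ 4 ^ (K - 1) ≤ 3 ^ (K - 1) * (smallRows S).card) := by
  induction hs : (smallRows S).card using Nat.strong_induction_on generalizing S with
  | _ s ih =>
    obtain hempty | hne := (pairing S).eq_empty_or_nonempty
    · exact ⟨0, fun _ => S, fun _ => 0, rfl, by simp, hempty, hS, Or.inl rfl⟩
    obtain ⟨t₀, S', hit, ht₀, hS', hrow⟩ := exists_iteration hS (hmax S hS).1 hne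
    have h1 := card_smallRows_add_card_le (hmax S hS).1 hS.1 hS'.1 hrow
    have h2 := card_smallRows_le (hmax S hS) hS hne
    have h3 := card_pos.2 hne
    obtain ⟨K, V, t, h0, hV, hend, hVK, hK⟩ := ih _ (by omega) hS' rfl
    refine ⟨K + 1, fun k => Nat.casesOn k S V, fun k => Nat.casesOn k t₀ t, rfl, ?_, hend, hVK,
      Or.inr ?_⟩
    · rintro (_ | k) hk
      · refine ⟨hne, ?_, ht₀⟩
        change Iteration (pairing S) t₀ S (V 0)
        rwa [h0]
      · exact hV k (by omega)
    · obtain rfl | ⟨K, rfl⟩ : K = 0 ∨ ∃ k, K = k + 1 := by cases K <;> simp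
      -- A single iteration needs only one small row, hence the exponent `K - 1`.
      · simp only [zero_add, Nat.sub_self, pow_zero, one_mul]
        omega
      · have hK := hK.resolve_left (by omega)
        simp only [Nat.add_sub_cancel] at hK ⊢
        calc 4 ^ (K + 1) = 4 ^ K * 4 := pow_succ _ _
          _ ≤ 3 ^ K * (smallRows S').card * 4 := Nat.mul_le_mul_right _ hK
          _ = 3 ^ K * (4 * (smallRows S').card) := by ring
          -- From `s' + p ≤ s` and `s ≤ 4 * p` for `p` pairs, `4 * s' ≤ 3 * s`.
          _ ≤ 3 ^ K * (3 * s) := Nat.mul_le_mul_left _ (by omega)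
          _ = 3 ^ (K + 1) * s := by ring

/-- Since `log (4 / 3) ≥ 1 / 4`, `K ≤ 4 * log n + 1`, and `1 ≤ 2 * log n` for `n ≥ 2`. -/
lemma le_log_of_pow_le {K : ℕ} (hn : 2 ≤ n) (h : 4 ^ (K - 1) ≤ 3 ^ (K - 1) * n) :
    (K : ℝ) ≤ 6 * Real.log n := by
  have hn' : (2 : ℝ) ≤ n := by exact_mod_cast hn
  have hlog2 : (1 : ℝ) / 2 ≤ Real.log n := by
    have h1 := Real.log_two_gt_d9
    have h2 := Real.log_le_log (by norm_num) hn'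
    linarith
  have hpow : ((4 : ℝ) / 3) ^ (K - 1) ≤ n := by
    rw [div_pow, div_le_iff₀ (by positivity), mul_comm]
    exact_mod_cast h
  have h43 : (1 : ℝ) / 4 ≤ Real.log (4 / 3) := by
    have := Real.one_sub_inv_le_log_of_pos (x := 4 / 3) (by norm_num)
    norm_num at this ⊢
    linarith
  have hlog := Real.log_le_log (by positivity) hpow
  rw [Real.log_pow] at hlog
  have hK : (K : ℝ) ≤ (K - 1 : ℕ) + 1 := by exact_mod_cast (show K ≤ K - 1 + 1 by omega)
  have hmul : ((K - 1 : ℕ) : ℝ) * (1 / 4) ≤ (K - 1 : ℕ) * Real.log (4 / 3) :=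
    mul_le_mul_of_nonneg_left h43 (Nat.cast_nonneg _)
  linarith

end Rows

end Amoebot

/-! ### Assembling the bounds -/

theorem mainTheorem5 :
    ∃ C : ℝ, 0 < C ∧
      ∀ (n : ℕ) (pairing : Amoebot.Config (Fin n) → Finset ℤ),
        (∀ T ∈ Amoebot.Arbitrary (Fin n), Amoebot.IsMaximumPairing T (pairing T)) →
        ∀ S ∈ Amoebot.Arbitrary (Fin n),
          ∃ (K : ℕ) (V : ℕ → Amoebot.Config (Fin n)) (t : ℕ → ℕ),
            V 0 = S ∧
            (∀ k < K, (pairing (V k)).Nonempty ∧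
              Amoebot.Iteration (pairing (V k)) (t k) (V k) (V (k + 1)) ∧
              (t k : ℝ) < √n) ∧
            pairing (V K) = ∅ ∧
            V K ∈ Amoebot.Bounded (Fin n) (√n) ∧
            (Amoebot.numRows (V K) : ℝ) ≤ √n ∧
            (K : ℝ) ≤ C * Real.log n ∧
            Amoebot.ReconfiguresIn S (V K) (∑ k ∈ Finset.range K, (1 + 5 * t k + 1)) ∧
            ((∑ k ∈ Finset.range K, (1 + 5 * t k + 1) : ℕ) : ℝ) ≤ C * (√n * Real.log n) := by
  -- `42 = 6 * 7`: at most `6 * log n` iterations of `2 + 5 * t ≤ 7 * √n` rounds each.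
  refine ⟨42, by norm_num, fun n pairing hmax S hS => ?_⟩
  obtain ⟨K, V, t, h0, hV, hend, hVK, hK⟩ := Amoebot.exists_iterations hmax hS
  have hrows : (Amoebot.numRows (V K) : ℝ) ≤ √n := by
    rw [Amoebot.numRows_eq hVK.1]
    exact Amoebot.card_rows_le_sqrt (hend ▸ hmax _ hVK) hVK
  have hrec : Amoebot.ReconfiguresIn S (V K) (∑ k ∈ Finset.range K, (1 + 5 * t k + 1)) := by
    rw [← h0]
    exact Amoebot.ReconfiguresIn.iterate fun k hk => (hV k hk).2.1.reconfiguresIn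
  have hlog : 0 ≤ Real.log n := Real.log_natCast_nonneg n
  have hKlog : (K : ℝ) ≤ 6 * Real.log n := by
    obtain rfl | hpos := Nat.eq_zero_or_pos K
    · simpa using hlog
    refine Amoebot.le_log_of_pow_le ?_ ((hK.resolve_left hpos.ne').trans
      (Nat.mul_le_mul_left _ ((card_filter_le _ _).trans (Amoebot.card_rows_le S))))
    -- If an iteration takes place, some pair consists of two non-empty rows, so `n ≥ 2`.
    have hne := (hV 0 hpos).1
    rw [h0] at hne
    obtain ⟨r, hr⟩ := hne
    obtain ⟨-, h1, h2, -⟩ := (hmax S hS).1 r hr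
    rw [Amoebot.rowCount_pos_iff hS.1] at h1 h2
    exact (one_lt_card.2 ⟨r, h1, r + 1, h2, by omega⟩).trans_le (Amoebot.card_rows_le S)
  have hsum : ((∑ k ∈ Finset.range K, (1 + 5 * t k + 1) : ℕ) : ℝ) ≤ K * (7 * √n) := by
    rw [Nat.cast_sum]
    calc ∑ k ∈ Finset.range K, ((1 + 5 * t k + 1 : ℕ) : ℝ)
        ≤ ∑ _k ∈ Finset.range K, 7 * √(n : ℝ) := by
          refine Finset.sum_le_sum fun k hk => ?_
          have h1 := (hV k (Finset.mem_range.1 hk)).2.2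
          have hn : 0 < n := by
            by_contra hn
            obtain rfl : n = 0 := by omega
            simp only [Nat.cast_zero, Real.sqrt_zero] at h1
            exact absurd h1 (not_lt.2 (Nat.cast_nonneg _))
          have h2 : (1 : ℝ) ≤ √n := Real.one_le_sqrt.2 (by exact_mod_cast hn)
          push_cast
          linarith
      _ = K * (7 * √n) := by rw [Finset.sum_const, Finset.card_range, nsmul_eq_mul]
  refine ⟨K, V, t, h0, hV, hend, ⟨hVK, Or.inl hrows⟩, hrows, by linarith, hrec, hsum.trans ?_⟩
  calc (K : ℝ) * (7 * √n) ≤ 6 * Real.log n * (7 * √n) :=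
        mul_le_mul_of_nonneg_right hKlog (by positivity)
    _ = 42 * (√n * Real.log n) := by ring
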